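/- Let $n\ge 1$, let $q,a,b,x_1,\dots,x_n\in\mathbb C$ with $0<|q|<1$, and write $(A)_k=\prod_{i=0}^{k-1}(1-Aq^i)$, $(A_1,\dots,A_l)_k=(A_1)_k\cdots(A_l)_k$. For multi-indices $\mathbf k=(k_1,\dots,k_n)$ of non-negative integers put $|\mathbf k|=k_1+\dots+k_n$, $q^{\mathbf k}=(q^{k_1},\dots,q^{k_n})$, and $$V(\mathbf k)=\prod_{1\le r<s\le n}\frac{1-q^{k_r-k_s}x_r/x_s}{1-x_r/x_s}.$$ Let $K$ be a complex-valued function of $\mathbf y=(y_1,\dots,y_n)\in\mathbb C^n$ and $\beta$ a complex-valued function on multi-indices. Assume that the denominators not involving $\mathbf y$ never vanish, i.e. for all $r$: $x_r\neq0$, $ax_rq^i\ne1$ and $bx_rq^i\neq1$ for all integers $i\ge0$, and $q^ix_r/x_s\ne1$ for all $r\neq s$ and $i\in\mathbb Z$. Consider the identity $$ \begin{aligned} K(\mathbf y)\sum_{\mathbf j\ge 0}{}&V(\mathbf j)\prod_{r,s=1}^n\Big(\frac{x_r}{x_sy_s}\Big)_{j_r}\prod_{r=1}^n\frac{1-bx_rq^{j_r+|\mathbf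 j|}}{(1-bx_r)(bqx_ry_r)_{|\mathbf j|}}\,(y_1\cdots y_n)^{|\mathbf j|}q^{\sum_{r}(r-1)j_r}\beta(\mathbf j)\\ =\sum_{\mathbf k\ge0}{}&V(\mathbf k)\prod_{r,s=1}^n\frac{(x_r/(x_sy_s))_{k_r}}{(qx_r/x_s)_{k_r}}\prod_{r=1}^n\frac{1-ax_rq^{k_r+|\mathbf k|}}{1-ax_r}\prod_{r=1}^n\frac{(ax_r)_{|\mathbf k|}}{(aqx_ry_r)_{|\mathbf k|}}\,(y_1\cdots y_n)^{|\mathbf k|}q^{\sum_r(r-1)k_r}\\ &\times\sum_{0\le j_r\le k_r}V(\mathbf j)\prod_{r,s=1}^n(q^{-k_s}x_r/x_s)_{j_r}\prod_{r=1}^n\frac{(ax_rq^{|\mathbf k|},bqx_r)_{j_r}}{(bx_r)_{j_r+|\mathbf j|}}(-1)^{|\mathbf j|}q^{\sum_r rj_r+\binom{|\mathbf j|}2}\beta(\mathbf j)\\ &\times\sum_{0\le m_r\le k_r-j_r}\ \prod_{1\le r<s\le n}\frac{1-q^{j_r-j_s+m_r-m_s}x_r/x_s}{1-q^{j_r-j_s}x_r/x_s}\;q^{\sum_r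 rm_r}K(q^{\mathbf j+\mathbf m})\\ &\quad\times\prod_{r,s=1}^n\frac{(q^{j_r-k_s}x_r/x_s)_{m_r}}{(q^{1+j_r-j_s}x_r/x_s)_{m_r}}\prod_{r=1}^n\frac{(ax_rq^{j_r+|\mathbf k|},bx_rq^{1+j_r})_{m_r}}{(aqx_r)_{j_r+m_r}(bx_rq^{1+j_r+|\mathbf j|})_{m_r}}, \end{aligned}\tag{1} $$ where $\prod_{r,s}(x_r/(x_sy_s))_{k_r}\,(y_1\cdots y_n)^{|\mathbf k|}$ is read as the polynomial $\prod_{r,s}\prod_{i=0}^{k_r-1}(y_s-q^ix_r/x_s)$, so that it makes sense also when some $y_s=0$. (i) Let $\rho_1,\dots,\rho_n>0$ be such that on the polydisc $D=\{\mathbf y:|y_r|<\rho_r\text{ for all }r\}$ the denominators $(aqx_ry_r)_l$, $(bqx_ry_r)_l$ $(l\ge0)$ never vanish, the series over $\mathbf j$ on the left and the outer series over $\mathbf k$ on the right converge absolutely at every point, and both sides of (1) are analytic functions of $\mathbf y$ on $D$. Then (1) holds for all $\mathbf y\in D$. (ii) If $y_r=q^{N_r}$ for $r=1,\dots,n$,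 with non-negative integers $N_r$, then in both series all terms vanish except those with $j_r\le N_r$ (respectively $k_r\le N_r$) for all $r$, and (1) holds. -/

import Mathlib

namespace AnSeries

/-- The `q`-rising factorial `(A; q)_k = (1 - A)(1 - A q) ⋯ (1 - A q^(k-1))`. -/
noncomputable def qRise (q A : ℂ) (k : ℕ) : ℂ :=
  ∏ i ∈ Finset.range k, (1 - A * q ^ i)

/-- The polynomial `∏_{i < k} (y - c q^i)` in `y`: it is the continuous extension to `y = 0` of
`(c / y; q)_k y^k` (see `qRiseInv_eq`). -/
noncomputable def qRiseInv (q c y : ℂ) (k : ℕ) : ℂ :=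
  ∏ i ∈ Finset.range k, (y - c * q ^ i)

theorem qRiseInv_eq (q c : ℂ) {y : ℂ} (hy : y ≠ 0) (k : ℕ) :
    qRiseInv q c y k = qRise q (c / y) k * y ^ k := by
  unfold qRiseInv qRise
  rw [← Finset.card_range k, ← Finset.prod_const, Finset.card_range, ← Finset.prod_mul_distrib]
  refine Finset.prod_congr rfl fun i _ => ?_
  field_simp

/-- The size `|k| = k_1 + ⋯ + k_n` of a multi-index. -/
def size {n : ℕ} (k : Fin n → ℕ) : ℕ := ∑ r, k r

/-- The point `q^N = (q^{N_1}, …, q^{N_n})`. -/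
noncomputable def qPow {n : ℕ} (q : ℂ) (N : Fin n → ℕ) : Fin n → ℂ := fun r => q ^ N r

/-- The Vandermonde factor of type `A`:
`∏_{1 ≤ r < s ≤ n} (1 - q^{k_r - k_s} x_r / x_s) / (1 - x_r / x_s)`. -/
noncomputable def vandermonde {n : ℕ} (q : ℂ) (x : Fin n → ℂ) (k : Fin n → ℕ) : ℂ :=
  ∏ r, ∏ s ∈ Finset.Ioi r,
    (1 - q ^ ((k r : ℤ) - (k s : ℤ)) * (x r / x s)) / (1 - x r / x s)

/-- `∏_{r,s=1}^n (x_r / (x_s y_s); q)_{k_r} · (y_1 ⋯ y_n)^{|k|}`, as a polynomial in `y`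
(see `numFactor_eq`). -/
noncomputable def numFactor {n : ℕ} (q : ℂ) (x : Fin n → ℂ) (k : Fin n → ℕ)
    (y : Fin n → ℂ) : ℂ :=
  ∏ r, ∏ s, qRiseInv q (x r / x s) (y s) (k r)

theorem numFactor_eq {n : ℕ} (q : ℂ) (x : Fin n → ℂ) (k : Fin n → ℕ) {y : Fin n → ℂ}
    (hy : ∀ s, y s ≠ 0) :
    numFactor q x k y =
      (∏ r, ∏ s, qRise q (x r / (x s * y s)) (k r)) * (∏ s, y s) ^ size k := by
  unfold numFactor size
  simp_rw [fun r s => qRiseInv_eq q (x r / x s) (hy s) (k r), Finset.prod_mul_distrib,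
    Finset.prod_pow, Finset.prod_pow_eq_pow_sum, div_div]

/-- The `j`-th term of the series on the left-hand side. The exponent `∑ (r - 1) j_r` is
`∑ r, r * j r` because `Fin n` is indexed from `0`. -/
noncomputable def lhsTerm {n : ℕ} (q b : ℂ) (x : Fin n → ℂ) (β : (Fin n → ℕ) → ℂ)
    (y : Fin n → ℂ) (j : Fin n → ℕ) : ℂ :=
  vandermonde q x j
    * numFactor q x j y
    * (∏ r, (1 - b * x r * q ^ (j r + size j)) /
        ((1 - b * x r) * qRise q (b * q * x r * y r) (size j)))
    * q ^ (∑ r : Fin n, (r : ℕ) * j r)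
    * β j

/-- The left-hand side `K(y) ∑_j …`. -/
noncomputable def lhs {n : ℕ} (q b : ℂ) (x : Fin n → ℂ) (K : (Fin n → ℂ) → ℂ)
    (β : (Fin n → ℕ) → ℂ) (y : Fin n → ℂ) : ℂ :=
  K y * ∑' j : Fin n → ℕ, lhsTerm q b x β y j

/-- The innermost sum on the right-hand side, over `0 ≤ m_r ≤ k_r - j_r` (used for `j ≤ k`). -/
noncomputable def innerSum {n : ℕ} (q a b : ℂ) (x : Fin n → ℂ) (K : (Fin n → ℂ) → ℂ)
    (k j : Fin n → ℕ) : ℂ :=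
  ∑ m ∈ Finset.Iic (k - j),
    (∏ r, ∏ s ∈ Finset.Ioi r,
        (1 - q ^ ((j r : ℤ) - (j s : ℤ) + (m r : ℤ) - (m s : ℤ)) * (x r / x s)) /
          (1 - q ^ ((j r : ℤ) - (j s : ℤ)) * (x r / x s)))
      * q ^ (∑ r : Fin n, ((r : ℕ) + 1) * m r)
      * K (qPow q (j + m))
      * (∏ r, ∏ s,
          qRise q (q ^ ((j r : ℤ) - (k s : ℤ)) * (x r / x s)) (m r) /
            qRise q (q ^ (1 + (j r : ℤ) - (j s : ℤ)) * (x r / x s)) (m r))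
      * ∏ r,
          qRise q (a * x r * q ^ (j r + size k)) (m r) * qRise q (b * x r * q ^ (1 + j r)) (m r) /
            (qRise q (a * q * x r) (j r + m r) *
              qRise q (b * x r * q ^ (1 + j r + size j)) (m r))

/-- The middle sum on the right-hand side, over `0 ≤ j_r ≤ k_r`. -/
noncomputable def middleSum {n : ℕ} (q a b : ℂ) (x : Fin n → ℂ) (K : (Fin n → ℂ) → ℂ)
    (β : (Fin n → ℕ) → ℂ) (k : Fin n → ℕ) : ℂ :=
  ∑ j ∈ Finset.Iic k,
    vandermonde q x j
      * (∏ r, ∏ s, qRise q (q ^ (-(k s : ℤ)) * (x r / x s)) (j r))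
      * (∏ r, qRise q (a * x r * q ^ size k) (j r) * qRise q (b * q * x r) (j r) /
          qRise q (b * x r) (j r + size j))
      * (-1) ^ size j
      * q ^ ((∑ r : Fin n, ((r : ℕ) + 1) * j r) + (size j).choose 2)
      * β j
      * innerSum q a b x K k j

/-- The `k`-th term of the outer series on the right-hand side. -/
noncomputable def rhsTerm {n : ℕ} (q a b : ℂ) (x : Fin n → ℂ) (K : (Fin n → ℂ) → ℂ)
    (β : (Fin n → ℕ) → ℂ) (y : Fin n → ℂ) (k : Fin n → ℕ) : ℂ :=
  vandermonde q x k
    * (numFactor q x k y / ∏ r, ∏ s, qRise q (q * (x r / x s)) (k r))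
    * (∏ r, (1 - a * x r * q ^ (k r + size k)) / (1 - a * x r))
    * (∏ r, qRise q (a * x r) (size k) / qRise q (a * q * x r * y r) (size k))
    * q ^ (∑ r : Fin n, (r : ℕ) * k r)
    * middleSum q a b x K β k

/-- The right-hand side. -/
noncomputable def rhs {n : ℕ} (q a b : ℂ) (x : Fin n → ℂ) (K : (Fin n → ℂ) → ℂ)
    (β : (Fin n → ℕ) → ℂ) (y : Fin n → ℂ) : ℂ :=
  ∑' k : Fin n → ℕ, rhsTerm q a b x K β y k

/-- The open polydisc `{y : |y_r| < ρ_r for all r}` around the origin. -/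
def polydisc {n : ℕ} (ρ : Fin n → ℝ) : Set (Fin n → ℂ) := {y | ∀ r, ‖y r‖ < ρ r}

end AnSeries

/-!
The right-hand side is the expansion of the left-hand side, as a function of `y`, in the basis
functions `Φ_k(y)`, where `Φ_k` is the `k`-th term of the left-hand series for `b = a` and a
suitable `β` (`basisWeight`). At the points `q^N` the matrix `F = (Φ_k(q^N))` is triangular, so
everything there is finite, and the claim is that `F` has the inverse `G` (`invKernel`) which is
implicit in the right-hand side.

A termwise rearrangement (`invKernel_mul_lhsTerm`, resting on the pairwise cancellations of
`vandermonde_mul_numFactor`) shows that applying `G` to the left-hand side produces the middle sum.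
The same rearrangement with `b = a` reduces `G F = 1` to the vanishing of a multiple sum over a box
`0 ≤ p ≤ M`, `M ≠ 0`. Its summand is a Vandermonde product of the points `u_r = X_r q^(p_r)` times
`∏ P(u_r) / ω'(u_r)`, where `ω` has the roots `X_r q^i`, `i ≤ M_r`, and `deg P < |M|`. Hence the sum
is a determinant, and its rows add up to zero by Lagrange interpolation
(`sum_prod_sub_mul_prod_eq_zero`, `sum_vandermonde_mul_qRise_eq_zero`). As the matrices are finite,
`G F = 1` gives `F G = 1`, which is the expansion (`expansion_qPow`) and hence the terminating
identity (`lhs_qPow_eq_rhs`).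

For analytic functions, the identity at the points `q^N`, which accumulate at the origin in each
variable, extends to the polydisc by the identity theorem, one variable at a time
(`eq_zero_of_qPow_eq_zero`).
-/

namespace AnSeries

/-! ### `q`-rising factorials -/

theorem qRise_zero (q A : ℂ) : qRise q A 0 = 1 := by simp [qRise]

theorem qRise_succ (q A : ℂ) (k : ℕ) : qRise q A (k + 1) = qRise q A k * (1 - A * q ^ k) :=
  Finset.prod_range_succ _ _

theorem qRise_add (q A : ℂ) (k m : ℕ) :
    qRise q A (k + m) = qRise q A k * qRise q (A * q ^ k) m := by
  simp only [qRise, Finset.prod_range_add, pow_add, mul_assoc]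

theorem qRise_succ' (q A : ℂ) (k : ℕ) : qRise q A (k + 1) = (1 - A) * qRise q (A * q) k := by
  rw [add_comm, qRise_add]
  simp [qRise]

theorem qRise_ne_zero {q A : ℂ} {k : ℕ} (h : ∀ i < k, A * q ^ i ≠ 1) : qRise q A k ≠ 0 :=
  Finset.prod_ne_zero_iff.2 fun i hi => sub_ne_zero.2 (h i (Finset.mem_range.1 hi)).symm

theorem qRise_eq_zero {q A : ℂ} {k i : ℕ} (hi : i < k) (h : A * q ^ i = 1) : qRise q A k = 0 :=
  Finset.prod_eq_zero (Finset.mem_range.2 hi) (by rw [h, sub_self])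

theorem qRiseInv_succ (q c y : ℂ) (k : ℕ) :
    qRiseInv q c y (k + 1) = qRiseInv q c y k * (y - c * q ^ k) :=
  Finset.prod_range_succ _ _

/-- Reversal of the order of the factors: each factor `q^(L + B) - v q^i` equals
`-v q^i (1 - w q^(L + B - i))`, where `w = v⁻¹`. -/
theorem qRiseInv_reverse {q v w : ℂ} (hq : q ≠ 0) (hvw : v * w = 1) (L : ℤ) (B : ℕ) :
    qRiseInv q v (q ^ (L + B)) B = (-v) ^ B * q ^ B.choose 2 * qRise q (q ^ (L + 1) * w) B := by
  induction B generalizing L with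
  | zero => simp [qRiseInv, qRise]
  | succ B ih =>
    have h := ih (L + 1)
    rw [show L + 1 + (B : ℤ) = L + (B + 1 : ℕ) by push_cast; ring] at h
    have e1 : q ^ (L + 1 + 1) * w = q ^ (L + 1) * w * q := by
      rw [mul_right_comm, ← zpow_add_one₀ hq]
    have e2 : q ^ (L + ((B + 1 : ℕ) : ℤ)) = q ^ (L + 1) * q ^ B := by
      rw [← zpow_natCast, ← zpow_add₀ hq]
      push_cast
      ring_nf
    rw [qRiseInv_succ, h, e1, qRise_succ', Nat.choose_succ_succ' B 1, Nat.choose_one_right, e2]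
    linear_combination ((-v) ^ B * q ^ B.choose 2 * qRise q (q ^ (L + 1) * w * q) B *
      (q ^ (L + 1) * q ^ B)) * -hvw

/-- Reversal of the order of the factors of `(w)_D`, where `w = v⁻¹`. -/
theorem qRise_reverse {q v w : ℂ} (hq : q ≠ 0) (hvw : v * w = 1) (D : ℕ) :
    qRise q (q ^ (1 - (D : ℤ)) * v) D * q ^ D.choose 2 = (-v) ^ D * qRise q w D := by
  induction D with
  | zero => simp [qRise]
  | succ D ih =>
    have h1 : q ^ (1 - ((D + 1 : ℕ) : ℤ)) * v * q = q ^ (1 - (D : ℤ)) * v := by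
      rw [mul_right_comm, ← zpow_add_one₀ hq]
      congr 2
      push_cast
      ring
    have h2 : q ^ (1 - ((D + 1 : ℕ) : ℤ)) * q ^ D = 1 := by
      rw [← zpow_natCast, ← zpow_add₀ hq]
      simp
    rw [qRise_succ', h1, qRise_succ, Nat.choose_succ_succ' D 1, Nat.choose_one_right,
      pow_add q D]
    linear_combination (1 - q ^ (1 - ((D + 1 : ℕ) : ℤ)) * v) * q ^ D * ih +
      (-v) ^ D * qRise q w D * (-v * h2 - q ^ D * hvw)

/-! ### The rearrangement of the `y`-dependent numerators at `y = q^l` -/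

theorem choose_two_add_mul (B D : ℕ) :
    (B + D).choose 2 + B.choose 2 + B = (B + D) * B + D.choose 2 := by
  induction B with
  | zero => simp
  | succ B ih =>
    rw [show B + 1 + D = B + D + 1 by ring, Nat.choose_succ_succ' (B + D) 1,
      Nat.choose_succ_succ' B 1, Nat.choose_one_right, Nat.choose_one_right]
    linarith

theorem qRiseInv_mul_qRise_diag {q : ℂ} (hq : q ≠ 0) (j m : ℕ) :
    qRiseInv q 1 (q ^ (j + m)) j * qRise q q m =
      (-1) ^ j * q ^ j.choose 2 * qRise q q (j + m) := by
  have h := qRiseInv_reverse hq (mul_one (1 : ℂ)) m j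
  rw [← Nat.cast_add, zpow_natCast, mul_one, zpow_add_one₀ hq, zpow_natCast] at h
  rw [add_comm j m, h, qRise_add q q m j, mul_comm (q ^ m) q]
  ring

theorem qRiseInv_pair_of_le {q v w : ℂ} (hq : q ≠ 0) (hvw : v * w = 1) (B D m p : ℕ) :
    qRiseInv q w (q ^ (B + p)) (B + D) * qRise q (q ^ (1 + ((B + D : ℕ) : ℤ) - B) * w) m *
        (qRiseInv q v (q ^ (B + D + m)) B * qRise q (q ^ (1 + (B : ℤ) - (B + D : ℕ)) * v) p) *
        (1 - q ^ (((B + D : ℕ) : ℤ) - B) * w) * q ^ B =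
      q ^ ((B + D) * B) * (1 - w) * qRise q (q * w) (B + D + m) * qRise q (q * v) (B + p) := by
  have e1 : (1 : ℤ) + ((B + D : ℕ) : ℤ) - B = D + 1 := by push_cast; ring
  have e2 : (1 : ℤ) + (B : ℤ) - (B + D : ℕ) = 1 - D := by push_cast; ring
  have e3 : (((B + D : ℕ) : ℤ) - B) = D := by push_cast; ring
  rw [e1, e2, e3, zpow_natCast]
  -- all the factors in `w`, and all those in `v`, are merged into one rising factorial each
  have hw : (1 - w) * qRise q (q * w) (B + D + m) =
      qRise q w D * (1 - q ^ D * w) * qRise q (q ^ ((D : ℤ) + 1) * w) (m + B) := by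
    rw [mul_comm q w, ← qRise_succ', show B + D + m + 1 = D + ((m + B) + 1) by ring, qRise_add,
      qRise_succ', zpow_add_one₀ hq, zpow_natCast]
    ring_nf
  have h1 := qRiseInv_reverse hq hvw (D + m) B
  rw [show (D : ℤ) + m + B = (B + D + m : ℕ) by push_cast; ring, zpow_natCast] at h1
  have h2 := qRiseInv_reverse hq ((mul_comm w v).trans hvw) (p - D) (B + D)
  rw [show (p : ℤ) - D + (B + D : ℕ) = (B + p : ℕ) by push_cast; ring, zpow_natCast] at h2
  have h3 : qRise q (q ^ ((D : ℤ) + 1) * w) (m + B) =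
      qRise q (q ^ ((D : ℤ) + 1) * w) m * qRise q (q ^ ((D : ℤ) + m + 1) * w) B := by
    rw [qRise_add, mul_right_comm, ← zpow_natCast, ← zpow_add₀ hq]
    ring_nf
  have h4 : qRise q (q ^ (1 - (D : ℤ)) * v) D * qRise q (q * v) (B + p) =
      qRise q (q ^ (1 - (D : ℤ)) * v) p * qRise q (q ^ ((p : ℤ) - D + 1) * v) (B + D) := by
    have a1 : q * v = q ^ (1 - (D : ℤ)) * v * q ^ D := by
      rw [mul_right_comm, ← zpow_natCast, ← zpow_add₀ hq]
      simp
    have a2 : q ^ ((p : ℤ) - D + 1) * v = q ^ (1 - (D : ℤ)) * v * q ^ p := by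
      rw [mul_right_comm, ← zpow_natCast, ← zpow_add₀ hq]
      ring_nf
    rw [a1, a2, ← qRise_add, ← qRise_add]
    ring_nf
  have h5 := qRise_reverse hq hvw D
  have h6 : (-w) ^ (B + D) * (-v) ^ B * (-v) ^ D = 1 := by
    rw [mul_assoc, ← pow_add, ← mul_pow, neg_mul_neg, mul_comm w v, hvw, one_pow]
  have h7 : q ^ (B + D).choose 2 * q ^ B.choose 2 * q ^ B = q ^ ((B + D) * B) * q ^ D.choose 2 := by
    rw [← pow_add, ← pow_add, ← pow_add, choose_two_add_mul]
  have hqD : q ^ D.choose 2 ≠ 0 := pow_ne_zero _ hq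
  apply mul_right_cancel₀ hqD
  rw [h1, h2]
  rw [mul_assoc (q ^ ((B + D) * B)), hw, h3]
  set R1 := qRise q (q ^ ((D : ℤ) + 1) * w) m
  set R2 := qRise q (q ^ ((D : ℤ) + m + 1) * w) B
  set S1 := qRise q (q ^ (1 - (D : ℤ)) * v) p
  set S2 := qRise q (q ^ ((p : ℤ) - D + 1) * v) (B + D)
  set T := qRise q (q ^ (1 - (D : ℤ)) * v) D
  set U := qRise q (q * v) (B + p)
  set W := qRise q w D
  calc _ = (-w) ^ (B + D) * (-v) ^ B * (q ^ (B + D).choose 2 * q ^ B.choose 2 * q ^ B) * R1 * R2 *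
        (S1 * S2) * (1 - q ^ D * w) * q ^ D.choose 2 := by ring
    _ = (-w) ^ (B + D) * (-v) ^ B * (q ^ ((B + D) * B) * q ^ D.choose 2) * R1 * R2 *
        U * (1 - q ^ D * w) * (T * q ^ D.choose 2) := by rw [h7, ← h4]; ring
    _ = (-w) ^ (B + D) * (-v) ^ B * (-v) ^ D * (q ^ ((B + D) * B) * q ^ D.choose 2) * R1 * R2 *
        U * (1 - q ^ D * w) * W := by rw [h5]; ring
    _ = _ := by rw [h6]; ring

/-- The contribution of the pairs `(r, s)` and `(s, r)` of indices to the numerators at `y = q^l`,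
where `A = j_r`, `B = j_s`, `A + m = l_r`, `B + p = l_s`, `w = x_r / x_s` and `v = x_s / x_r`. -/
theorem qRiseInv_pair {q v w : ℂ} (hq : q ≠ 0) (hvw : v * w = 1) (A B m p : ℕ) :
    qRiseInv q w (q ^ (B + p)) A * qRise q (q ^ (1 + (A : ℤ) - B) * w) m *
        (qRiseInv q v (q ^ (A + m)) B * qRise q (q ^ (1 + (B : ℤ) - A) * v) p) *
        (1 - q ^ ((A : ℤ) - B) * w) * q ^ B =
      q ^ (A * B) * (1 - w) * qRise q (q * w) (A + m) * qRise q (q * v) (B + p) := by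
  rcases le_total B A with h | h
  · obtain ⟨D, rfl⟩ := Nat.exists_eq_add_of_le h
    exact qRiseInv_pair_of_le hq hvw B D m p
  · obtain ⟨D, rfl⟩ := Nat.exists_eq_add_of_le h
    have h1 := qRiseInv_pair_of_le hq ((mul_comm w v).trans hvw) A D p m
    have hv : v ≠ 0 := left_ne_zero_of_mul_eq_one hvw
    -- the identity is symmetric up to the factor `-v`
    apply mul_left_cancel₀ (neg_ne_zero.2 hv)
    have e1 : -v * (1 - w) = 1 - v := by linear_combination hvw
    have e2 : -v * ((1 - q ^ ((A : ℤ) - (A + D : ℕ)) * w) * q ^ (A + D)) =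
        (1 - q ^ (((A + D : ℕ) : ℤ) - A) * v) * q ^ A := by
      have a1 : q ^ ((A : ℤ) - (A + D : ℕ)) * q ^ (A + D) = q ^ A := by
        rw [← zpow_natCast, ← zpow_natCast, ← zpow_add₀ hq]
        simp
      have a2 : q ^ (((A + D : ℕ) : ℤ) - A) * q ^ A = q ^ (A + D) := by
        rw [← zpow_natCast, ← zpow_natCast, ← zpow_add₀ hq]
        simp [add_comm]
      linear_combination v * w * a1 + v * a2 + q ^ A * hvw
    rw [mul_comm (A + D) A] at h1
    linear_combination h1 - q ^ (A * (A + D)) * qRise q (q * w) (A + m) *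
        qRise q (q * v) (A + D + p) * e1 +
      qRiseInv q w (q ^ (A + D + p)) A * qRise q (q ^ (1 + (A : ℤ) - (A + D : ℕ)) * w) m *
        (qRiseInv q v (q ^ (A + m)) (A + D) *
          qRise q (q ^ (1 + ((A + D : ℕ) : ℤ) - A) * v) p) * e2

theorem prod_prod_eq_diag_mul_pairs {n : ℕ} {M : Type*} [CommMonoid M] (f : Fin n → Fin n → M) :
    ∏ r, ∏ s, f r s = (∏ r, f r r) * ∏ r, ∏ s ∈ Finset.Ioi r, f r s * f s r := by
  have h := Finset.prod_prod_Ioi_mul_eq_prod_prod_off_diag fun s r => f r s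
  rw [h, ← Finset.prod_mul_distrib]
  exact Finset.prod_congr rfl fun r _ => Fintype.prod_eq_mul_prod_compl r fun s => f r s

theorem sum_val_mul_eq_sum_Ioi {n : ℕ} (j : Fin n → ℕ) :
    ∑ r : Fin n, (r : ℕ) * j r = ∑ r, ∑ s ∈ Finset.Ioi r, j s := by
  rw [Finset.sum_comm' (s' := fun s => Finset.Iio s) (t' := Finset.univ) (by simp)]
  simp

theorem choose_two_mul_two_add (k : ℕ) : k.choose 2 * 2 + k = k * k := by
  rw [Nat.choose_two_right, Nat.div_mul_cancel (even_iff_two_dvd.1 (Nat.even_mul_pred_self k))]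
  cases k <;> simp [Nat.mul_succ]

theorem choose_two_size {n : ℕ} (j : Fin n → ℕ) :
    (size j).choose 2 = ∑ r, (j r).choose 2 + ∑ r, ∑ s ∈ Finset.Ioi r, j r * j s := by
  have h : size j * size j =
      ∑ r, j r * j r + ∑ r, ∑ s ∈ Finset.Ioi r, (j r * j s + j s * j r) := by
    have h := prod_prod_eq_diag_mul_pairs (M := Multiplicative ℕ)
      fun r s => Multiplicative.ofAdd (j r * j s)
    rw [size, Finset.sum_mul_sum]
    exact h
  have h1 := choose_two_mul_two_add (size j)
  have h2 : ∑ r, j r * j r = (∑ r, (j r).choose 2) * 2 + size j := by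
    simp_rw [← choose_two_mul_two_add, Finset.sum_add_distrib, Finset.sum_mul, size]
  have h3 : ∑ r, ∑ s ∈ Finset.Ioi r, (j r * j s + j s * j r) =
      (∑ r, ∑ s ∈ Finset.Ioi r, j r * j s) * 2 := by
    simp_rw [Finset.sum_mul]
    refine Finset.sum_congr rfl fun r _ => Finset.sum_congr rfl fun s _ => by ring
  omega

/-- The numerators of the left-hand series at `y = q^(j + m)`: after cancellations between the pairs
`(r, s)` and `(s, r)`, the rising factorials depend on `j` and `m` only through `j + m`. -/
theorem vandermonde_mul_numFactor {n : ℕ} {q : ℂ} {x : Fin n → ℂ} (hq : q ≠ 0)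
    (hx0 : ∀ r, x r ≠ 0) (hx : ∀ r s, r ≠ s → x r / x s ≠ 1) (j m : Fin n → ℕ) :
    vandermonde q x j * numFactor q x j (qPow q (j + m)) * q ^ (∑ r : Fin n, (r : ℕ) * j r) *
        (∏ r, ∏ s, qRise q (q ^ (1 + (j r : ℤ) - (j s : ℤ)) * (x r / x s)) (m r)) =
      (-1) ^ size j * q ^ (size j).choose 2 *
        ∏ r, ∏ s, qRise q (q * (x r / x s)) (j r + m r) := by
  have hpow : q ^ (∑ r : Fin n, (r : ℕ) * j r) = ∏ r, ∏ s ∈ Finset.Ioi r, q ^ j s := by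
    simp_rw [sum_val_mul_eq_sum_Ioi, Finset.prod_pow_eq_pow_sum]
  have hch : q ^ (size j).choose 2 =
      (∏ r, q ^ (j r).choose 2) * ∏ r, ∏ s ∈ Finset.Ioi r, q ^ (j r * j s) := by
    simp_rw [choose_two_size, pow_add, Finset.prod_pow_eq_pow_sum]
  have hsgn : (-1 : ℂ) ^ size j = ∏ r, (-1) ^ j r := by
    rw [Finset.prod_pow_eq_pow_sum, size]
  have hdiag : ∀ r, qRiseInv q (x r / x r) (qPow q (j + m) r) (j r) *
      qRise q (q ^ (1 + (j r : ℤ) - j r) * (x r / x r)) (m r) =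
      (-1) ^ j r * q ^ (j r).choose 2 * qRise q (q * (x r / x r)) (j r + m r) := fun r => by
    have := qRiseInv_mul_qRise_diag hq (j r) (m r)
    simpa [div_self (hx0 r), qPow] using this
  have hpair : ∀ r, ∀ s ∈ Finset.Ioi r,
      (1 - q ^ ((j r : ℤ) - j s) * (x r / x s)) / (1 - x r / x s) * q ^ j s *
        (qRiseInv q (x r / x s) (qPow q (j + m) s) (j r) *
            qRise q (q ^ (1 + (j r : ℤ) - j s) * (x r / x s)) (m r) *
          (qRiseInv q (x s / x r) (qPow q (j + m) r) (j s) *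
            qRise q (q ^ (1 + (j s : ℤ) - j r) * (x s / x r)) (m s))) =
      q ^ (j r * j s) * (qRise q (q * (x r / x s)) (j r + m r) *
        qRise q (q * (x s / x r)) (j s + m s)) := fun r s hs => by
    have hne : 1 - x r / x s ≠ 0 :=
      sub_ne_zero.2 (hx r s (Finset.mem_Ioi.1 hs).ne).symm
    have hvw : x s / x r * (x r / x s) = 1 := by
      have := hx0 r
      have := hx0 s
      field_simp
    have h := qRiseInv_pair hq hvw (j r) (j s) (m r) (m s)
    apply mul_left_cancel₀ hne
    have hd := div_mul_cancel₀ (1 - q ^ ((j r : ℤ) - j s) * (x r / x s)) hne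
    simp only [qPow, Pi.add_apply]
    linear_combination h + q ^ j s * (qRiseInv q (x r / x s) (q ^ (j s + m s)) (j r) *
      qRise q (q ^ (1 + (j r : ℤ) - j s) * (x r / x s)) (m r) *
        (qRiseInv q (x s / x r) (q ^ (j r + m r)) (j s) *
          qRise q (q ^ (1 + (j s : ℤ) - j r) * (x s / x r)) (m s))) * hd
  calc
    _ = (∏ r, ∏ s ∈ Finset.Ioi r,
          (1 - q ^ ((j r : ℤ) - j s) * (x r / x s)) / (1 - x r / x s) * q ^ j s) *
        ∏ r, ∏ s, qRiseInv q (x r / x s) (qPow q (j + m) s) (j r) *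
          qRise q (q ^ (1 + (j r : ℤ) - j s) * (x r / x s)) (m r) := by
      rw [hpow, numFactor, vandermonde]
      simp_rw [Finset.prod_mul_distrib]
      ring
    _ = (∏ r, (-1) ^ j r * q ^ (j r).choose 2 * qRise q (q * (x r / x r)) (j r + m r)) *
        ∏ r, ∏ s ∈ Finset.Ioi r, q ^ (j r * j s) * (qRise q (q * (x r / x s)) (j r + m r) *
          qRise q (q * (x s / x r)) (j s + m s)) := by
      rw [prod_prod_eq_diag_mul_pairs, mul_left_comm, Finset.prod_congr rfl fun r _ => hdiag r]
      congr 1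
      simp_rw [← Finset.prod_mul_distrib]
      exact Finset.prod_congr rfl fun r _ => Finset.prod_congr rfl fun s hs => hpair r s hs
    _ = _ := by
      rw [prod_prod_eq_diag_mul_pairs, hch, hsgn]
      simp_rw [Finset.prod_mul_distrib]
      ring

/-! ### Divided differences over a product of groups of nodes -/

open Polynomial in
/-- Let `ω` be the monic polynomial whose simple roots are all the nodes `z r i`, `i ≤ M r`. By
multilinearity, the sum is the determinant of the matrix whose `(r, s)` entry is the sum of
`z^s P(z) / ω'(z)` over the `r`-th group of nodes. The rows of that matrix add up to the divided
difference of `z^s P(z)` at all the nodes, which vanishes because the degree is too small. -/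
theorem sum_prod_sub_mul_prod_eq_zero {F : Type*} [Field F] {n : ℕ} (z : Fin n → ℕ → F)
    (M : Fin n → ℕ)
    (hz : Set.InjOn (fun t : (_ : Fin n) × ℕ => z t.1 t.2)
      (Finset.univ.sigma fun s => Finset.range (M s + 1) : Finset ((_ : Fin n) × ℕ)))
    (P : F[X]) (hP : P.natDegree < ∑ r, M r) :
    ∑ p ∈ Finset.Iic M, (∏ r, ∏ s ∈ Finset.Ioi r, (z s (p s) - z r (p r))) *
      ∏ r, (P.eval (z r (p r)) /
        ∏ t ∈ (Finset.univ.sigma fun s => Finset.range (M s + 1)).erase ⟨r, p r⟩,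
          (z r (p r) - z t.1 t.2)) = 0 := by
  set S : Finset ((_ : Fin n) × ℕ) := Finset.univ.sigma fun s => Finset.range (M s + 1) with hS
  set h : Fin n → ℕ → F := fun r i =>
    P.eval (z r i) / ∏ t ∈ S.erase ⟨r, i⟩, (z r i - z t.1 t.2) with hh
  have hcard : S.card = ∑ r, M r + n := by
    simp [hS, Finset.card_sigma, Finset.sum_add_distrib]
  have hIic : Finset.Iic M = Fintype.piFinset fun r => Finset.range (M r + 1) := by
    ext p
    simp [Pi.le_def]
  calc
    _ = ∑ p ∈ Fintype.piFinset fun r => Finset.range (M r + 1),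
          Matrix.det (Matrix.of fun r (s : Fin n) => h r (p r) * z r (p r) ^ (s : ℕ)) := by
      rw [hIic]
      refine Finset.sum_congr rfl fun p _ => ?_
      have := Matrix.det_mul_column (fun r => h r (p r)) (Matrix.vandermonde fun r => z r (p r))
      rw [Matrix.det_vandermonde, mul_comm] at this
      exact this.symm
    _ = Matrix.det (Matrix.of fun r (s : Fin n) =>
          ∑ i ∈ Finset.range (M r + 1), h r i * z r i ^ (s : ℕ)) := by
      have := (Matrix.detRowAlternating (R := F) (n := Fin n)).toMultilinearMap.map_sum_finset
        (fun r i => fun s : Fin n => h r i * z r i ^ (s : ℕ)) (fun r => Finset.range (M r + 1))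
      refine this.symm.trans (congrArg _ ?_)
      ext r s
      simp
    _ = 0 := by
      have hn : 0 < n := by
        rcases Nat.eq_zero_or_pos n with rfl | hn
        · simp at hP
        · exact hn
      have : Nonempty (Fin n) := ⟨⟨0, hn⟩⟩
      -- the sum of all the rows is zero
      refine Matrix.exists_vecMul_eq_zero_iff.1 ⟨1, one_ne_zero, ?_⟩
      ext s
      have hdeg : (X ^ (s : ℕ) * P).natDegree < S.card - 1 := by
        refine natDegree_mul_le.trans_lt ?_
        rw [natDegree_X_pow, hcard]
        have := s.2
        omega
      have hlt : (X ^ (s : ℕ) * P).degree < (S.card : WithBot ℕ) :=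
        degree_le_natDegree.trans_lt (Nat.cast_lt.2 (hdeg.trans_le (Nat.sub_le _ _)))
      have hc := Lagrange.coeff_eq_sum hz hlt
      rw [coeff_eq_zero_of_natDegree_lt hdeg, hS, Finset.sum_sigma] at hc
      simp only [Matrix.vecMul, dotProduct, Matrix.of_apply, Pi.one_apply, one_mul, Pi.zero_apply]
      refine Eq.trans ?_ hc.symm
      refine Finset.sum_congr rfl fun r _ => Finset.sum_congr rfl fun i _ => ?_
      simp only [hh, eval_mul, eval_pow, eval_X]
      ring

/-- Evaluation of the polynomial with the roots `Y q^i`, `i ≤ M`, at `X q^p`, relative to its value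
at `X`. -/
theorem prod_range_sub_mul_qRise {q X Y : ℂ} (hq : q ≠ 0) (hY : Y ≠ 0) (M p : ℕ) :
    (∏ i ∈ Finset.range (M + 1), (X * q ^ p - Y * q ^ i)) *
        qRise q (q ^ (-(M : ℤ)) * (X / Y)) p =
      (∏ i ∈ Finset.range (M + 1), (X * q ^ 0 - Y * q ^ i)) * qRise q (q * (X / Y)) p := by
  induction p with
  | zero => simp [qRise]
  | succ p ih =>
    have h1 : ∏ i ∈ Finset.range (M + 1), (X * q ^ (p + 1) - Y * q ^ i) =
        q ^ M * (∏ i ∈ Finset.range M, (X * q ^ p - Y * q ^ i)) * (X * q ^ (p + 1) - Y) := by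
      rw [Finset.prod_range_succ', pow_zero, mul_one]
      congr 1
      conv_rhs => rw [← Finset.card_range M, ← Finset.prod_const, Finset.card_range,
        ← Finset.prod_mul_distrib]
      exact Finset.prod_congr rfl fun i _ => by ring
    have h2 : q ^ M * q ^ (-(M : ℤ)) = 1 := by
      rw [zpow_neg, zpow_natCast, mul_inv_cancel₀ (pow_ne_zero _ hq)]
    rw [Finset.prod_range_succ] at ih
    rw [qRise_succ, qRise_succ, h1]
    obtain ⟨w, rfl⟩ : ∃ w, X = w * Y := ⟨X / Y, (div_mul_cancel₀ X hY).symm⟩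
    rw [mul_div_cancel_right₀ w hY] at *
    linear_combination (1 - q * w * q ^ p) * ih +
      (∏ i ∈ Finset.range M, (w * Y * q ^ p - Y * q ^ i)) * (w * Y * q ^ (p + 1) - Y) *
        qRise q (q ^ (-(M : ℤ)) * w) p * (-w * q ^ p) * h2

/-- The analogue of `prod_range_sub_mul_qRise` for `Y = X`, where the vanishing factor is left out
and an additional power of `q` appears. -/
theorem prod_range_ite_sub_mul_qRise {q X : ℂ} (hq : q ≠ 0) (M p : ℕ) (hp : p ≤ M) :
    (∏ i ∈ Finset.range (M + 1), if i = p then 1 else X * q ^ p - X * q ^ i) *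
        (q ^ p * qRise q (q ^ (-(M : ℤ))) p) =
      (∏ i ∈ Finset.range (M + 1), if i = 0 then 1 else X * q ^ 0 - X * q ^ i) * qRise q q p := by
  induction p with
  | zero => simp [qRise]
  | succ p ih =>
    have h1 : q * ∏ i ∈ Finset.range (M + 1),
          (if i = p + 1 then 1 else X * q ^ (p + 1) - X * q ^ i) =
        q ^ M * (∏ i ∈ Finset.range M, if i = p then 1 else X * q ^ p - X * q ^ i) *
          (X * q ^ (p + 1) - X) := by
      rw [Finset.prod_range_succ', if_neg (Nat.succ_ne_zero p).symm, pow_zero, mul_one, ← mul_assoc]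
      congr 1
      have h3 : q = ∏ i ∈ Finset.range M, if i = p then q else 1 := by
        rw [Finset.prod_ite_eq', if_pos (Finset.mem_range.2 hp)]
      conv_lhs => enter [1]; rw [h3]
      conv_rhs => rw [← Finset.card_range M, ← Finset.prod_const, Finset.card_range]
      rw [← Finset.prod_mul_distrib, ← Finset.prod_mul_distrib]
      refine Finset.prod_congr rfl fun i _ => ?_
      by_cases hi : i = p
      · simp [hi]
      · simp only [hi, add_left_inj, if_false]
        ring
    have h2 : q ^ M * q ^ (-(M : ℤ)) = 1 := by
      rw [zpow_neg, zpow_natCast, mul_inv_cancel₀ (pow_ne_zero _ hq)]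
    have ih := ih (Nat.le_of_succ_le hp)
    rw [Finset.prod_range_succ, if_neg (by omega)] at ih
    rw [qRise_succ, qRise_succ]
    linear_combination (1 - q * q ^ p) * ih +
      q ^ p * qRise q (q ^ (-(M : ℤ))) p * (1 - q ^ (-(M : ℤ)) * q ^ p) * h1 +
      (∏ i ∈ Finset.range M, if i = p then 1 else X * q ^ p - X * q ^ i) *
        (X * q ^ (p + 1) - X) * q ^ p * qRise q (q ^ (-(M : ℤ))) p * (-q ^ p) * h2

/-- The derivative, at the node `X_r q^p`, of the polynomial with the simple roots
`X_s q^i`, `0 ≤ i ≤ M_s`. -/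
noncomputable def nodalDeriv {n : ℕ} (q : ℂ) (X : Fin n → ℂ) (M : Fin n → ℕ) (r : Fin n) (p : ℕ) :
    ℂ :=
  ∏ t ∈ (Finset.univ.sigma fun s => Finset.range (M s + 1)).erase ⟨r, p⟩,
    (X r * q ^ p - X t.1 * q ^ t.2)

theorem nodalDeriv_eq {n : ℕ} (q : ℂ) (X : Fin n → ℂ) (M : Fin n → ℕ) (r : Fin n) {p : ℕ}
    (hp : p ≤ M r) :
    nodalDeriv q X M r p = ∏ s, if s = r then
        ∏ i ∈ Finset.range (M r + 1), (if i = p then 1 else X r * q ^ p - X r * q ^ i)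
      else ∏ i ∈ Finset.range (M s + 1), (X r * q ^ p - X s * q ^ i) := by
  have hmem : (⟨r, p⟩ : (_ : Fin n) × ℕ) ∈ Finset.univ.sigma fun s => Finset.range (M s + 1) := by
    simp only [Finset.mem_sigma, Finset.mem_univ, Finset.mem_range, true_and]
    omega
  have h : nodalDeriv q X M r p = ∏ t ∈ Finset.univ.sigma fun s => Finset.range (M s + 1),
      if t = ⟨r, p⟩ then 1 else X r * q ^ p - X t.1 * q ^ t.2 := by
    rw [← Finset.mul_prod_erase _ _ hmem, if_pos rfl, one_mul]
    exact Finset.prod_congr rfl fun t ht => (if_neg (Finset.ne_of_mem_erase ht)).symm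
  rw [h, Finset.prod_sigma]
  refine Finset.prod_congr rfl fun s _ => ?_
  split_ifs with hs
  · subst hs
    refine Finset.prod_congr rfl fun i _ => ?_
    simp
  · refine Finset.prod_congr rfl fun i _ => ?_
    rw [if_neg]
    simp [hs]

/-- The `r`-th factor of the summand of the multiple series is a constant times the reciprocal of
the derivative of the nodal polynomial. -/
theorem nodalDeriv_mul_prod_qRise {n : ℕ} {q : ℂ} (hq : q ≠ 0) {X : Fin n → ℂ}
    (hX0 : ∀ r, X r ≠ 0) (M : Fin n → ℕ) (r : Fin n) {p : ℕ} (hp : p ≤ M r) :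
    nodalDeriv q X M r p * (q ^ p * ∏ s, qRise q (q ^ (-(M s : ℤ)) * (X r / X s)) p) =
      nodalDeriv q X M r 0 * ∏ s, qRise q (q * (X r / X s)) p := by
  have hqp : q ^ p = ∏ s, if s = r then q ^ p else 1 := by simp
  rw [nodalDeriv_eq q X M r hp, nodalDeriv_eq q X M r (Nat.zero_le _), hqp,
    ← Finset.prod_mul_distrib, ← Finset.prod_mul_distrib, ← Finset.prod_mul_distrib]
  refine Finset.prod_congr rfl fun s _ => ?_
  by_cases hs : s = r
  · subst hs
    simpa [div_self (hX0 s)] using prod_range_ite_sub_mul_qRise (X := X s) hq (M s) p hp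
  · simpa [hs] using prod_range_sub_mul_qRise (X := X r) hq (hX0 s) (M s) p

/-! ### Non-vanishing of the denominators -/

theorem pow_ne_one_of_norm_lt_one {q : ℂ} (hq1 : ‖q‖ < 1) {i : ℕ} (hi : i ≠ 0) : q ^ i ≠ 1 :=
  fun h => (pow_lt_one₀ (norm_nonneg q) hq1 hi).ne (by rw [← norm_pow, h, norm_one])

theorem pow_injective_of_norm_lt_one {q : ℂ} (hq : q ≠ 0) (hq1 : ‖q‖ < 1) :
    Function.Injective fun i : ℕ => q ^ i := fun i k h =>
  pow_right_injective₀ (norm_pos_iff.2 hq) hq1.ne (by simpa using congrArg norm h)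

theorem nodes_injective {n : ℕ} {q : ℂ} (hq : q ≠ 0) (hq1 : ‖q‖ < 1) {X : Fin n → ℂ}
    (hX0 : ∀ r, X r ≠ 0) (hX : ∀ r s, r ≠ s → ∀ i : ℤ, q ^ i * (X r / X s) ≠ 1) :
    Function.Injective fun t : (_ : Fin n) × ℕ => X t.1 * q ^ t.2 := by
  rintro ⟨r, i⟩ ⟨s, k⟩ h
  simp only at h
  by_cases hrs : r = s
  · subst hrs
    rw [pow_injective_of_norm_lt_one hq hq1 (mul_left_cancel₀ (hX0 r) h)]
  · refine absurd ?_ (hX r s hrs (i - k))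
    have := hX0 s
    have := pow_ne_zero k hq
    rw [zpow_sub₀ hq, zpow_natCast, zpow_natCast]
    field_simp
    rw [mul_comm, h, mul_comm]

/-- For `r ≠ s` this is the hypothesis on the ratios; for `r = s` the factors are `1 - q^(i + 1)`,
which do not vanish because `|q| < 1`. -/
theorem qRise_ratio_ne_zero {n : ℕ} {q : ℂ} (hq : q ≠ 0) (hq1 : ‖q‖ < 1) {x : Fin n → ℂ}
    (hx0 : ∀ r, x r ≠ 0) (hx : ∀ r s, r ≠ s → ∀ i : ℤ, q ^ i * (x r / x s) ≠ 1)
    (j : Fin n → ℕ) (r s : Fin n) (k : ℕ) :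
    qRise q (q ^ (1 + (j r : ℤ) - (j s : ℤ)) * (x r / x s)) k ≠ 0 := by
  refine qRise_ne_zero fun i _ => ?_
  by_cases hrs : r = s
  · subst hrs
    rw [add_sub_cancel_right, zpow_one, div_self (hx0 r), mul_one, ← pow_succ']
    exact pow_ne_one_of_norm_lt_one hq1 i.succ_ne_zero
  · rw [mul_right_comm, ← zpow_natCast, ← zpow_add₀ hq]
    exact hx r s hrs _

/-! ### The vanishing sum -/

/-- The factor `V(p)` in terms of the Vandermonde product of the points `X_r q^(p_r)`. -/
theorem vandermonde_mul_pow {n : ℕ} {q : ℂ} (hq : q ≠ 0) {X : Fin n → ℂ}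
    (hX0 : ∀ r, X r ≠ 0) (hX : ∀ r s, r ≠ s → X r / X s ≠ 1) (p : Fin n → ℕ) :
    vandermonde q X p * q ^ (∑ r : Fin n, (r : ℕ) * p r) *
        ∏ r, ∏ s ∈ Finset.Ioi r, (X s - X r) =
      ∏ r, ∏ s ∈ Finset.Ioi r, (X s * q ^ p s - X r * q ^ p r) := by
  rw [vandermonde, sum_val_mul_eq_sum_Ioi]
  simp_rw [← Finset.prod_pow_eq_pow_sum, ← Finset.prod_mul_distrib]
  refine Finset.prod_congr rfl fun r _ => Finset.prod_congr rfl fun s hs => ?_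
  have hne : 1 - X r / X s ≠ 0 := sub_ne_zero.2 (hX r s (Finset.mem_Ioi.1 hs).ne).symm
  have h1 : X s - X r = (1 - X r / X s) * X s := by
    rw [sub_mul, div_mul_cancel₀ _ (hX0 s), one_mul]
  have h2 : q ^ ((p r : ℤ) - p s) * q ^ p s = q ^ p r := by
    rw [← zpow_natCast, ← zpow_add₀ hq, sub_add_cancel, zpow_natCast]
  rw [h1, div_mul_eq_mul_div, ← mul_assoc, div_mul_cancel₀ _ hne]
  linear_combination -(X r / X s * X s) * h2 - q ^ p r * div_mul_cancel₀ (X r) (hX0 s)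

open Polynomial in
/-- The vanishing of the multiple sum that makes the two kernels inverse to each other. The summand
at `p` is, up to a constant independent of `p`, the Vandermonde product of the points `X_r q^(p_r)`
times a product over `r` of values of `P / ω'`, with a polynomial `P` of degree less than `|M|`. -/
theorem sum_vandermonde_mul_qRise_eq_zero {n : ℕ} {q A : ℂ} (hq : q ≠ 0) (hq1 : ‖q‖ < 1)
    {X : Fin n → ℂ} (hX0 : ∀ r, X r ≠ 0)
    (hX : ∀ r s, r ≠ s → ∀ i : ℤ, q ^ i * (X r / X s) ≠ 1)
    (hA : ∀ r, ∀ i : ℕ, A * q * X r * q ^ i ≠ 1) {M : Fin n → ℕ} (hM : M ≠ 0) :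
    ∑ p ∈ Finset.Iic M, vandermonde q X p * q ^ (∑ r : Fin n, ((r : ℕ) + 1) * p r) *
      (∏ r, ∏ s, qRise q (q ^ (-(M s : ℤ)) * (X r / X s)) (p r) /
        qRise q (q * (X r / X s)) (p r)) *
      ∏ r, qRise q (A * X r * q ^ size M) (p r) / qRise q (A * q * X r) (p r) = 0 := by
  have hX1 : ∀ r s, r ≠ s → X r / X s ≠ 1 := fun r s hrs => by simpa using hX r s hrs 0
  have hsize : size M ≠ 0 := fun h => hM <| funext fun r =>
    (Finset.sum_eq_zero_iff.1 h) r (Finset.mem_univ r)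
  obtain ⟨d, hd⟩ := Nat.exists_eq_succ_of_ne_zero hsize
  -- `(A X_r q^|M|)_p / (A q X_r)_p = P (X_r q^p) / P (X_r)`, with `P` of degree `|M| - 1`
  set P : ℂ[X] := ∏ i ∈ Finset.range d, (1 - C (A * q * q ^ i) * Polynomial.X) with hPdef
  have hPdeg : P.natDegree < ∑ r, M r := by
    have : P.natDegree ≤ ∑ i ∈ Finset.range d, 1 := by
      refine (natDegree_prod_le _ _).trans (Finset.sum_le_sum fun i _ => ?_)
      refine (natDegree_sub_le _ _).trans (max_le (by simp) ?_)
      exact (natDegree_C_mul_le _ _).trans natDegree_X_le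
    simp only [Finset.sum_const, Finset.card_range, smul_eq_mul, mul_one] at this
    have : size M = ∑ r, M r := rfl
    omega
  have hPeval : ∀ u, P.eval u = qRise q (A * q * u) d := fun u => by
    simp only [hPdef, eval_prod, qRise, eval_sub, eval_one, eval_mul, eval_C, eval_X]
    exact Finset.prod_congr rfl fun i _ => by ring
  have hinj := nodes_injective hq hq1 hX0 hX
  have key := sum_prod_sub_mul_prod_eq_zero (fun r i => X r * q ^ i) M hinj.injOn P hPdeg
  have hnod : ∀ r i, nodalDeriv q X M r i ≠ 0 := fun r i =>
    Finset.prod_ne_zero_iff.2 fun t ht => sub_ne_zero.2 fun h =>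
      Finset.ne_of_mem_erase ht (hinj h).symm
  have hV : ∏ r, ∏ s ∈ Finset.Ioi r, (X s - X r) ≠ 0 :=
    Finset.prod_ne_zero_iff.2 fun r _ => Finset.prod_ne_zero_iff.2 fun s hs =>
      sub_ne_zero.2 fun h => hX1 r s (Finset.mem_Ioi.1 hs).ne (by rw [h, div_self (hX0 r)])
  have hP0 : ∀ r, P.eval (X r) ≠ 0 := fun r => by
    rw [hPeval]
    exact qRise_ne_zero fun i _ => hA r i
  -- after clearing the constant `∏ (X_s - X_r)`, the summands agree up to a constant factor
  apply (mul_eq_zero_iff_right hV).1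
  refine Eq.trans ?_ (mul_eq_zero_of_left key (∏ r, nodalDeriv q X M r 0 / P.eval (X r)))
  rw [Finset.sum_mul, Finset.sum_mul]
  refine Finset.sum_congr rfl fun p hp => ?_
  rw [← vandermonde_mul_pow hq hX0 hX1]
  have hfac : q ^ (∑ r, p r) * (∏ r, ∏ s, qRise q (q ^ (-(M s : ℤ)) * (X r / X s)) (p r) /
        qRise q (q * (X r / X s)) (p r)) *
      (∏ r, qRise q (A * X r * q ^ size M) (p r) / qRise q (A * q * X r) (p r)) =
      (∏ r, P.eval (X r * q ^ p r) / nodalDeriv q X M r (p r)) *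
        ∏ r, nodalDeriv q X M r 0 / P.eval (X r) := by
    rw [← Finset.prod_pow_eq_pow_sum]
    simp_rw [← Finset.prod_mul_distrib]
    refine Finset.prod_congr rfl fun r _ => ?_
    have h1 := nodalDeriv_mul_prod_qRise hq hX0 M r (Finset.mem_Iic.1 hp r)
    have h2 : qRise q (A * X r * q ^ size M) (p r) * P.eval (X r) =
        qRise q (A * q * X r) (p r) * P.eval (X r * q ^ p r) := by
      rw [hPeval, hPeval, hd, ← mul_assoc (A * q), ← qRise_add, add_comm (p r), qRise_add,
        Nat.succ_eq_add_one]
      ring_nf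
    have h3 : ∏ s, qRise q (q * (X r / X s)) (p r) ≠ 0 := Finset.prod_ne_zero_iff.2 fun s _ => by
      simpa using qRise_ratio_ne_zero hq hq1 hX0 hX 0 r s (p r)
    have h4 : qRise q (A * q * X r) (p r) ≠ 0 := qRise_ne_zero fun i _ => hA r i
    have h5 := hnod r (p r)
    have h6 := hP0 r
    rw [Finset.prod_div_distrib]
    simp only [mul_div_assoc'] at h1 h3 ⊢
    generalize qRise q (A * q * X r) (p r) = B1 at *
    generalize ∏ s, qRise q (q * X r / X s) (p r) = B2 at *
    generalize ∏ s, qRise q (q ^ (-(M s : ℤ)) * X r / X s) (p r) = B3 at *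
    generalize P.eval (X r) = B4 at *
    generalize P.eval (X r * q ^ p r) = B5 at *
    generalize qRise q (A * X r * q ^ size M) (p r) = B6 at *
    generalize nodalDeriv q X M r (p r) = B7 at *
    field_simp
    linear_combination B6 * B4 * h1 + nodalDeriv q X M r 0 * B2 * h2
  have hexp : ∑ r : Fin n, ((r : ℕ) + 1) * p r = ∑ r : Fin n, (r : ℕ) * p r + ∑ r, p r := by
    simp_rw [add_mul, one_mul, Finset.sum_add_distrib]
  rw [hexp, pow_add]
  simp only [nodalDeriv] at hfac ⊢
  linear_combination vandermonde q X p * q ^ (∑ r : Fin n, (r : ℕ) * p r) *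
    (∏ r, ∏ s ∈ Finset.Ioi r, (X s - X r)) * hfac

/-! ### The expansion kernels -/

/-- The coefficient of `f (q^l)` in the `k`-th coefficient of the expansion of a function `f`
given on the points `q^l`. -/
noncomputable def invKernel {n : ℕ} (q a : ℂ) (x : Fin n → ℂ) (k l : Fin n → ℕ) : ℂ :=
  vandermonde q x l
    * (∏ r, ∏ s, qRise q (q ^ (-(k s : ℤ)) * (x r / x s)) (l r) / qRise q (q * (x r / x s)) (l r))
    * (∏ r, qRise q (a * x r * q ^ size k) (l r) / qRise q (a * q * x r) (l r))
    * q ^ (∑ r : Fin n, ((r : ℕ) + 1) * l r)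

/-- The values of `β` for which the terms of the left-hand series with `b = a` become the basis
functions of the expansion. With this choice a single lemma, `invKernel_mul_lhsTerm`, serves both
to invert the kernel and to expand the left-hand side. -/
noncomputable def basisWeight {n : ℕ} (q a : ℂ) (x : Fin n → ℂ) (k : Fin n → ℕ) : ℂ :=
  (∏ r, qRise q (a * x r) (size k)) / ∏ r, ∏ s, qRise q (q * (x r / x s)) (k r)

/-- The coefficient of `β j * innerSum q a b x K k j` in the middle sum. -/
noncomputable def middleWeight {n : ℕ} (q a b : ℂ) (x : Fin n → ℂ) (k j : Fin n → ℕ) : ℂ :=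
  vandermonde q x j
    * (∏ r, ∏ s, qRise q (q ^ (-(k s : ℤ)) * (x r / x s)) (j r))
    * (∏ r, qRise q (a * x r * q ^ size k) (j r) * qRise q (b * q * x r) (j r) /
        qRise q (b * x r) (j r + size j))
    * (-1) ^ size j
    * q ^ ((∑ r : Fin n, ((r : ℕ) + 1) * j r) + (size j).choose 2)

/-- The coefficient of `K (q^(j + m))` in the inner sum. -/
noncomputable def innerWeight {n : ℕ} (q a b : ℂ) (x : Fin n → ℂ) (k j m : Fin n → ℕ) : ℂ :=
  (∏ r, ∏ s ∈ Finset.Ioi r,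
      (1 - q ^ ((j r : ℤ) - (j s : ℤ) + (m r : ℤ) - (m s : ℤ)) * (x r / x s)) /
        (1 - q ^ ((j r : ℤ) - (j s : ℤ)) * (x r / x s)))
    * q ^ (∑ r : Fin n, ((r : ℕ) + 1) * m r)
    * (∏ r, ∏ s,
        qRise q (q ^ ((j r : ℤ) - (k s : ℤ)) * (x r / x s)) (m r) /
          qRise q (q ^ (1 + (j r : ℤ) - (j s : ℤ)) * (x r / x s)) (m r))
    * ∏ r,
        qRise q (a * x r * q ^ (j r + size k)) (m r) * qRise q (b * x r * q ^ (1 + j r)) (m r) /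
          (qRise q (a * q * x r) (j r + m r) *
            qRise q (b * x r * q ^ (1 + j r + size j)) (m r))

theorem innerSum_eq {n : ℕ} (q a b : ℂ) (x : Fin n → ℂ) (K : (Fin n → ℂ) → ℂ)
    (k j : Fin n → ℕ) :
    innerSum q a b x K k j =
      ∑ m ∈ Finset.Iic (k - j), innerWeight q a b x k j m * K (qPow q (j + m)) :=
  Finset.sum_congr rfl fun m _ => by rw [innerWeight]; ring

theorem middleSum_eq {n : ℕ} (q a b : ℂ) (x : Fin n → ℂ) (K : (Fin n → ℂ) → ℂ)
    (β : (Fin n → ℕ) → ℂ) (k : Fin n → ℕ) :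
    middleSum q a b x K β k =
      ∑ j ∈ Finset.Iic k, middleWeight q a b x k j * β j * innerSum q a b x K k j := rfl

/-- The terms of the right-hand series are multiples of the basis functions of the expansion. -/
theorem rhsTerm_eq {n : ℕ} (q a b : ℂ) (x : Fin n → ℂ) (K : (Fin n → ℂ) → ℂ)
    (β : (Fin n → ℕ) → ℂ) (y : Fin n → ℂ) (k : Fin n → ℕ) :
    rhsTerm q a b x K β y k =
      lhsTerm q a x (basisWeight q a x) y k * middleSum q a b x K β k := by
  rw [rhsTerm, lhsTerm, basisWeight]
  simp_rw [Finset.prod_div_distrib, Finset.prod_mul_distrib]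
  ring

/-! ### Terms that vanish -/

theorem numFactor_qPow_eq_zero {n : ℕ} {q : ℂ} {x : Fin n → ℂ} (hx0 : ∀ r, x r ≠ 0)
    {N k : Fin n → ℕ} (h : ¬ k ≤ N) : numFactor q x k (qPow q N) = 0 := by
  obtain ⟨r, hr⟩ := not_forall.1 h
  refine Finset.prod_eq_zero (Finset.mem_univ r) (Finset.prod_eq_zero (Finset.mem_univ r) ?_)
  refine Finset.prod_eq_zero (Finset.mem_range.2 (not_le.1 hr)) ?_
  simp [qPow, div_self (hx0 r)]

theorem lhsTerm_qPow_eq_zero {n : ℕ} {q : ℂ} {x : Fin n → ℂ} (hx0 : ∀ r, x r ≠ 0) (b : ℂ)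
    (β : (Fin n → ℕ) → ℂ) {N j : Fin n → ℕ} (h : ¬ j ≤ N) :
    lhsTerm q b x β (qPow q N) j = 0 := by
  simp [lhsTerm, numFactor_qPow_eq_zero hx0 h]

theorem invKernel_eq_zero {n : ℕ} {q : ℂ} (hq : q ≠ 0) {x : Fin n → ℂ} (hx0 : ∀ r, x r ≠ 0)
    (a : ℂ) {k l : Fin n → ℕ} (h : ¬ l ≤ k) : invKernel q a x k l = 0 := by
  obtain ⟨r, hr⟩ := not_forall.1 h
  have h0 : ∏ r, ∏ s, qRise q (q ^ (-(k s : ℤ)) * (x r / x s)) (l r) /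
      qRise q (q * (x r / x s)) (l r) = 0 := by
    refine Finset.prod_eq_zero (Finset.mem_univ r) (Finset.prod_eq_zero (Finset.mem_univ r) ?_)
    rw [qRise_eq_zero (not_le.1 hr), zero_div]
    rw [div_self (hx0 r), mul_one, zpow_neg, zpow_natCast, inv_mul_cancel₀ (pow_ne_zero _ hq)]
  rw [invKernel, h0, mul_zero, zero_mul, zero_mul]

theorem sum_Iic_eq_sum_add {n : ℕ} {f : (Fin n → ℕ) → ℂ} {j k : Fin n → ℕ} (hjk : j ≤ k)
    (hf : ∀ l, ¬ j ≤ l → f l = 0) :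
    ∑ l ∈ Finset.Iic k, f l = ∑ m ∈ Finset.Iic (k - j), f (j + m) := by
  symm
  refine Finset.sum_of_injOn (fun m => j + m) (add_right_injective j).injOn ?_ ?_ fun _ _ => rfl
  · intro m hm
    have hm := Finset.mem_Iic.1 (Finset.mem_coe.1 hm)
    exact Finset.mem_coe.2 (Finset.mem_Iic.2
      ((add_le_add_right hm j).trans_eq (add_tsub_cancel_of_le hjk)))
  · intro l hl hl'
    refine hf l fun hjl => hl' ⟨l - j, ?_, add_tsub_cancel_of_le hjl⟩
    exact Finset.mem_coe.2 (Finset.mem_Iic.2 (tsub_le_tsub_right (Finset.mem_Iic.1 hl) j))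

/-! ### The termwise rearrangement -/

theorem vandermonde_add {n : ℕ} {q : ℂ} {x : Fin n → ℂ}
    (hx : ∀ r s, r ≠ s → ∀ i : ℤ, q ^ i * (x r / x s) ≠ 1) (j m : Fin n → ℕ) :
    vandermonde q x (j + m) = vandermonde q x j * ∏ r, ∏ s ∈ Finset.Ioi r,
      (1 - q ^ ((j r : ℤ) - (j s : ℤ) + (m r : ℤ) - (m s : ℤ)) * (x r / x s)) /
        (1 - q ^ ((j r : ℤ) - (j s : ℤ)) * (x r / x s)) := by
  rw [vandermonde, vandermonde]
  simp_rw [← Finset.prod_mul_distrib]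
  refine Finset.prod_congr rfl fun r _ => Finset.prod_congr rfl fun s hs => ?_
  have hne := sub_ne_zero.2 (hx r s (Finset.mem_Ioi.1 hs).ne (j r - j s)).symm
  have he : ((j + m) r : ℤ) - (j + m) s = j r - j s + m r - m s := by
    simp only [Pi.add_apply]
    push_cast
    ring
  rw [mul_comm (_ / (1 - x r / x s)), div_mul_div_cancel₀ hne, he]

theorem prod_qRise_neg_add {n : ℕ} {q : ℂ} (hq : q ≠ 0) (x : Fin n → ℂ) (k j m : Fin n → ℕ) :
    ∏ r, ∏ s, qRise q (q ^ (-(k s : ℤ)) * (x r / x s)) (j r + m r) =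
      (∏ r, ∏ s, qRise q (q ^ (-(k s : ℤ)) * (x r / x s)) (j r)) *
        ∏ r, ∏ s, qRise q (q ^ ((j r : ℤ) - (k s : ℤ)) * (x r / x s)) (m r) := by
  simp_rw [← Finset.prod_mul_distrib]
  refine Finset.prod_congr rfl fun r _ => Finset.prod_congr rfl fun s _ => ?_
  rw [qRise_add, mul_right_comm, ← zpow_natCast, ← zpow_add₀ hq, neg_add_eq_sub]

/-- The factors of `(c)_(j + J + 1 + m)`, split off in two ways. -/
theorem qRise_mul_one_sub_mul (q c : ℂ) (j J m : ℕ) :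
    qRise q c (j + J) * (1 - c * q ^ (j + J)) * qRise q (c * q ^ (1 + j + J)) m =
      (1 - c) * (qRise q (c * q) (j + m) * qRise q (c * q * q ^ (j + m)) J) := by
  rw [← qRise_add, ← qRise_succ', ← qRise_succ, show 1 + j + J = j + J + 1 by ring, ← qRise_add]
  ring_nf

/-- The product of the inverse kernel with a term of the left-hand series is a summand of the
double sum over `j` and `m` on the right-hand side. -/
theorem invKernel_mul_lhsTerm {n : ℕ} {q a b : ℂ} {x : Fin n → ℂ} (hq : q ≠ 0) (hq1 : ‖q‖ < 1)
    (hx0 : ∀ r, x r ≠ 0) (hx : ∀ r s, r ≠ s → ∀ i : ℤ, q ^ i * (x r / x s) ≠ 1)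
    (hb : ∀ r, ∀ i : ℕ, b * x r * q ^ i ≠ 1) (β : (Fin n → ℕ) → ℂ) (k j m : Fin n → ℕ) :
    invKernel q a x k (j + m) * lhsTerm q b x β (qPow q (j + m)) j =
      middleWeight q a b x k j * β j * innerWeight q a b x k j m := by
  have hcore := vandermonde_mul_numFactor hq hx0 (fun r s hrs => by simpa using hx r s hrs 0) j m
  have hD : ∏ r, ∏ s, qRise q (q ^ (1 + (j r : ℤ) - (j s : ℤ)) * (x r / x s)) (m r) ≠ 0 :=
    Finset.prod_ne_zero_iff.2 fun r _ => Finset.prod_ne_zero_iff.2 fun s _ =>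
      qRise_ratio_ne_zero hq hq1 hx0 hx j r s (m r)
  have hN : ∏ r, ∏ s, qRise q (q * (x r / x s)) (j r + m r) ≠ 0 :=
    Finset.prod_ne_zero_iff.2 fun r _ => Finset.prod_ne_zero_iff.2 fun s _ => by
      simpa using qRise_ratio_ne_zero hq hq1 hx0 hx 0 r s (j r + m r)
  have hAB : (∏ r, qRise q (a * x r * q ^ size k) (j r + m r) /
        qRise q (a * q * x r) (j r + m r)) *
      (∏ r, (1 - b * x r * q ^ (j r + size j)) /
        ((1 - b * x r) * qRise q (b * q * x r * q ^ (j r + m r)) (size j))) =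
      (∏ r, qRise q (a * x r * q ^ size k) (j r) * qRise q (b * q * x r) (j r) /
        qRise q (b * x r) (j r + size j)) *
      ∏ r,
        qRise q (a * x r * q ^ (j r + size k)) (m r) * qRise q (b * x r * q ^ (1 + j r)) (m r) /
          (qRise q (a * q * x r) (j r + m r) *
            qRise q (b * x r * q ^ (1 + j r + size j)) (m r)) := by
    simp_rw [← Finset.prod_mul_distrib]
    refine Finset.prod_congr rfl fun r _ => ?_
    have h1 := qRise_mul_one_sub_mul q (b * x r) (j r) (size j) (m r)
    have h2 : qRise q (a * x r * q ^ size k) (j r + m r) =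
        qRise q (a * x r * q ^ size k) (j r) * qRise q (a * x r * q ^ (j r + size k)) (m r) := by
      rw [qRise_add]
      ring_nf
    have h3 : qRise q (b * x r * q) (j r + m r) =
        qRise q (b * x r * q) (j r) * qRise q (b * x r * q ^ (1 + j r)) (m r) := by
      rw [qRise_add]
      ring_nf
    rw [h3] at h1
    rw [h2, mul_right_comm b q]
    have n0 : 1 - b * x r ≠ 0 := sub_ne_zero.2 (by simpa using (hb r 0).symm)
    have n1 : qRise q (b * x r * q * q ^ (j r + m r)) (size j) ≠ 0 := qRise_ne_zero fun i _ => by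
      have := hb r (1 + (j r + m r) + i)
      rwa [pow_add, pow_add, pow_one, ← mul_assoc, ← mul_assoc] at this
    have n2 : qRise q (b * x r) (j r + size j) ≠ 0 := qRise_ne_zero fun i _ => hb r i
    have n3 : qRise q (b * x r * q ^ (1 + j r + size j)) (m r) ≠ 0 := qRise_ne_zero fun i _ => by
      have := hb r (1 + j r + size j + i)
      rwa [pow_add, ← mul_assoc] at this
    have h4 : (1 - b * x r * q ^ (j r + size j)) /
        ((1 - b * x r) * qRise q (b * x r * q * q ^ (j r + m r)) (size j)) =
        qRise q (b * x r * q) (j r) * qRise q (b * x r * q ^ (1 + j r)) (m r) /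
          (qRise q (b * x r) (j r + size j) *
            qRise q (b * x r * q ^ (1 + j r + size j)) (m r)) := by
      rw [div_eq_div_iff (mul_ne_zero n0 n1) (mul_ne_zero n2 n3)]
      linear_combination h1
    rw [h4, div_mul_div_comm, div_mul_div_comm]
    ring
  have hexp : ∑ r : Fin n, ((r : ℕ) + 1) * (j + m) r =
      ∑ r : Fin n, ((r : ℕ) + 1) * j r + ∑ r : Fin n, ((r : ℕ) + 1) * m r := by
    simp_rw [Pi.add_apply, mul_add, Finset.sum_add_distrib]
  have hZN : ∏ r, ∏ s, qRise q (q ^ (-(k s : ℤ)) * (x r / x s)) (j r + m r) /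
        qRise q (q * (x r / x s)) (j r + m r) =
      (∏ r, ∏ s, qRise q (q ^ (-(k s : ℤ)) * (x r / x s)) (j r)) *
        (∏ r, ∏ s, qRise q (q ^ ((j r : ℤ) - (k s : ℤ)) * (x r / x s)) (m r)) /
        ∏ r, ∏ s, qRise q (q * (x r / x s)) (j r + m r) := by
    rw [← prod_qRise_neg_add hq]
    simp_rw [Finset.prod_div_distrib]
  have hZD : ∏ r, ∏ s, qRise q (q ^ ((j r : ℤ) - (k s : ℤ)) * (x r / x s)) (m r) /
        qRise q (q ^ (1 + (j r : ℤ) - (j s : ℤ)) * (x r / x s)) (m r) =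
      (∏ r, ∏ s, qRise q (q ^ ((j r : ℤ) - (k s : ℤ)) * (x r / x s)) (m r)) /
        ∏ r, ∏ s, qRise q (q ^ (1 + (j r : ℤ) - (j s : ℤ)) * (x r / x s)) (m r) := by
    simp_rw [Finset.prod_div_distrib]
  rw [invKernel, lhsTerm, middleWeight, innerWeight, vandermonde_add hx, hexp, hZD]
  have hy : ∀ r, qPow q (j + m) r = q ^ (j r + m r) := fun r => rfl
  simp only [Pi.add_apply, hZN, hy]
  simp only [pow_add q (∑ r : Fin n, ((r : ℕ) + 1) * j r)]
  generalize (∏ r, ∏ s, qRise q (q ^ (1 + (j r : ℤ) - (j s : ℤ)) * (x r / x s)) (m r)) = D at *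
  generalize (∏ r, ∏ s, qRise q (q * (x r / x s)) (j r + m r)) = N at *
  generalize (∏ r, ∏ s, qRise q (q ^ ((j r : ℤ) - (k s : ℤ)) * (x r / x s)) (m r)) = Zm at *
  generalize (∏ r, ∏ s, qRise q (q ^ (-(k s : ℤ)) * (x r / x s)) (j r)) = Zj at *
  generalize (∏ r, qRise q (a * x r * q ^ size k) (j r + m r) /
    qRise q (a * q * x r) (j r + m r)) = A1 at *
  generalize (∏ r, (1 - b * x r * q ^ (j r + size j)) /
    ((1 - b * x r) * qRise q (b * q * x r * q ^ (j r + m r)) (size j))) = B1 at *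
  generalize (∏ r, qRise q (a * x r * q ^ size k) (j r) * qRise q (b * q * x r) (j r) /
    qRise q (b * x r) (j r + size j)) = A2 at *
  generalize (∏ r,
        qRise q (a * x r * q ^ (j r + size k)) (m r) * qRise q (b * x r * q ^ (1 + j r)) (m r) /
          (qRise q (a * q * x r) (j r + m r) *
            qRise q (b * x r * q ^ (1 + j r + size j)) (m r))) = B2 at *
  generalize (∏ r, ∏ s ∈ Finset.Ioi r,
      (1 - q ^ ((j r : ℤ) - (j s : ℤ) + (m r : ℤ) - (m s : ℤ)) * (x r / x s)) /
        (1 - q ^ ((j r : ℤ) - (j s : ℤ)) * (x r / x s))) = W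
  generalize vandermonde q x j = V at *
  generalize numFactor q x j (qPow q (j + m)) = F at *
  generalize q ^ (∑ r : Fin n, (r : ℕ) * j r) = E0 at *
  generalize q ^ (∑ r : Fin n, ((r : ℕ) + 1) * j r) = E1
  generalize q ^ (∑ r : Fin n, ((r : ℕ) + 1) * m r) = E2
  generalize q ^ (size j).choose 2 = C at *
  generalize (-1 : ℂ) ^ size j = S at *
  generalize β j = b0
  clear hZN hZD hexp hy
  calc _ = V * W * (Zj * Zm / N) * (A1 * B1) * (E1 * E2) * b0 * (V * F * E0 * D) / D := by
        rw [eq_div_iff hD]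
        ring
    _ = V * W * (Zj * Zm / N) * (A2 * B2) * (E1 * E2) * b0 * (S * C * N) / D := by
        rw [hAB, hcore]
    _ = V * W * (Zj * Zm / N * N) * (A2 * B2) * (E1 * E2) * b0 * (S * C) / D := by ring
    _ = _ := by
        rw [div_mul_cancel₀ _ hN]
        ring

/-- The diagonal entries of the two kernels are inverse to each other. -/
theorem invKernel_self_mul_lhsTerm {n : ℕ} {q a : ℂ} {x : Fin n → ℂ} (hq : q ≠ 0) (hq1 : ‖q‖ < 1)
    (hx0 : ∀ r, x r ≠ 0) (hx : ∀ r s, r ≠ s → ∀ i : ℤ, q ^ i * (x r / x s) ≠ 1)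
    (ha : ∀ r, ∀ i : ℕ, a * x r * q ^ i ≠ 1) (k : Fin n → ℕ) :
    invKernel q a x k k * lhsTerm q a x (basisWeight q a x) (qPow q k) k = 1 := by
  have hcore := vandermonde_mul_numFactor hq hx0 (fun r s hrs => by simpa using hx r s hrs 0) k 0
  simp only [Pi.zero_apply, qRise_zero, Finset.prod_const_one, mul_one, add_zero] at hcore
  have hN : ∏ r, ∏ s, qRise q (q * (x r / x s)) (k r) ≠ 0 :=
    Finset.prod_ne_zero_iff.2 fun r _ => Finset.prod_ne_zero_iff.2 fun s _ => by
      simpa using qRise_ratio_ne_zero hq hq1 hx0 hx 0 r s (k r)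
  have hnum : numFactor q x k (qPow q k) =
      (∏ r, ∏ s, qRise q (q ^ (-(k s : ℤ)) * (x r / x s)) (k r)) * q ^ (size k * size k) := by
    have hprod : ∏ s, qPow q k s = q ^ size k := by
      simp only [qPow, Finset.prod_pow_eq_pow_sum, size]
    rw [numFactor_eq q x k (y := qPow q k) (fun s => pow_ne_zero _ hq), hprod, ← pow_mul]
    simp only [qPow]
    congr 1
    refine Finset.prod_congr rfl fun r _ => Finset.prod_congr rfl fun s _ => ?_
    rw [zpow_neg, zpow_natCast, mul_comm (x s), ← div_div, div_right_comm, inv_mul_eq_div]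
  have hA : (∏ r, qRise q (a * x r * q ^ size k) (k r) / qRise q (a * q * x r) (k r)) *
      (∏ r, (1 - a * x r * q ^ (k r + size k)) /
        ((1 - a * x r) * qRise q (a * q * x r * q ^ k r) (size k))) *
      ∏ r, qRise q (a * x r) (size k) = 1 := by
    simp_rw [← Finset.prod_mul_distrib]
    refine Finset.prod_eq_one fun r _ => ?_
    have h1 := qRise_mul_one_sub_mul q (a * x r) (size k) (k r) 0
    rw [qRise_zero, mul_one, add_zero, qRise_add, mul_right_comm a (x r) q] at h1
    have h2 : qRise q (a * q * x r) (size k + k r) =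
        qRise q (a * q * x r) (k r) * qRise q (a * q * x r * q ^ k r) (size k) := by
      rw [add_comm, qRise_add]
    have h3 : qRise q (a * q * x r) (size k + k r) =
        qRise q (a * q * x r) (size k) * qRise q (a * q * x r * q ^ size k) (k r) := by
      rw [qRise_add]
    have n0 : 1 - a * x r ≠ 0 := sub_ne_zero.2 (by simpa using (ha r 0).symm)
    have n1 : qRise q (a * q * x r) (size k + k r) ≠ 0 := qRise_ne_zero fun i _ => by
      have := ha r (1 + i)
      rwa [pow_add, pow_one, ← mul_assoc, mul_right_comm a] at this
    rw [h2] at n1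
    have n2 := left_ne_zero_of_mul n1
    have n3 := right_ne_zero_of_mul n1
    rw [← h3, h2, add_comm (size k)] at h1
    rw [div_mul_div_comm, div_mul_eq_mul_div, div_eq_one_iff_eq (by positivity)]
    linear_combination h1
  have hexp : q ^ (∑ r : Fin n, ((r : ℕ) + 1) * k r) = q ^ (∑ r : Fin n, (r : ℕ) * k r) *
      q ^ size k := by
    simp_rw [← pow_add, add_mul, one_mul, Finset.sum_add_distrib, size]
  have hsq : q ^ (size k * size k) = (q ^ (size k).choose 2) ^ 2 * q ^ size k := by
    rw [← choose_two_mul_two_add, pow_add, pow_mul]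
  have hsgn : ((-1 : ℂ) ^ size k) ^ 2 = 1 := by rw [← pow_mul, mul_comm, pow_mul]; simp
  have hZ : ∏ r, ∏ s, qRise q (q ^ (-(k s : ℤ)) * (x r / x s)) (k r) /
        qRise q (q * (x r / x s)) (k r) =
      (∏ r, ∏ s, qRise q (q ^ (-(k s : ℤ)) * (x r / x s)) (k r)) /
        ∏ r, ∏ s, qRise q (q * (x r / x s)) (k r) := by
    simp_rw [Finset.prod_div_distrib]
  have hy : ∀ r, qPow q k r = q ^ k r := fun r => rfl
  rw [invKernel, lhsTerm, basisWeight, hZ, hexp]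
  simp only [hy]
  have hC : q ^ (size k).choose 2 ≠ 0 := pow_ne_zero _ hq
  rw [hsq] at hnum
  generalize (∏ r, qRise q (a * x r * q ^ size k) (k r) / qRise q (a * q * x r) (k r)) = A1 at *
  generalize (∏ r, (1 - a * x r * q ^ (k r + size k)) /
        ((1 - a * x r) * qRise q (a * q * x r * q ^ k r) (size k))) = A2 at *
  generalize ∏ r, qRise q (a * x r) (size k) = A3 at *
  generalize (∏ r, ∏ s, qRise q (q ^ (-(k s : ℤ)) * (x r / x s)) (k r)) = Z at *
  generalize (∏ r, ∏ s, qRise q (q * (x r / x s)) (k r)) = N at *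
  generalize numFactor q x k (qPow q k) = F at *
  generalize vandermonde q x k = V at *
  generalize q ^ (∑ r : Fin n, (r : ℕ) * k r) = E at *
  generalize q ^ (size k).choose 2 = C at *
  generalize q ^ size k = Q at *
  generalize (-1 : ℂ) ^ size k = S at *
  have h : C ^ 2 * (V * Z * E * Q * (V * F * E)) = C ^ 2 * N ^ 2 := by
    calc _ = (V * (Z * (C ^ 2 * Q)) * E) * (V * F * E) := by ring
      _ = (S * C * N) * (S * C * N) := by rw [← hnum, hcore]
      _ = S ^ 2 * (C ^ 2 * N ^ 2) := by ring
      _ = _ := by rw [hsgn, one_mul]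
  have h := mul_left_cancel₀ (pow_ne_zero 2 hC) h
  calc _ = (A1 * A2 * A3) * (V * Z * E * Q * (V * F * E)) / N ^ 2 := by
        field_simp
    _ = 1 := by rw [h, hA, one_mul, div_self (pow_ne_zero 2 hN)]

/-! ### The inverse pair of kernels and the expansion -/

theorem size_add {n : ℕ} (j m : Fin n → ℕ) : size (j + m) = size j + size m :=
  Finset.sum_add_distrib

/-- For `b = a` the inner weight is a constant times the summand of
`sum_vandermonde_mul_qRise_eq_zero`, for the points `X_r = x_r q^(j_r)` and `A = a q^|j|`. -/
theorem innerWeight_same {n : ℕ} {q a : ℂ} {x : Fin n → ℂ} (hq : q ≠ 0)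
    (ha : ∀ r, ∀ i : ℕ, a * x r * q ^ i ≠ 1) (j M p : Fin n → ℕ) :
    innerWeight q a a x (j + M) j p =
      (∏ r, (qRise q (a * q * x r) (j r))⁻¹) *
        (vandermonde q (fun r => x r * q ^ j r) p * q ^ (∑ r : Fin n, ((r : ℕ) + 1) * p r) *
      (∏ r, ∏ s, qRise q (q ^ (-(M s : ℤ)) * (x r * q ^ j r / (x s * q ^ j s))) (p r) /
        qRise q (q * (x r * q ^ j r / (x s * q ^ j s))) (p r)) *
      ∏ r, qRise q (a * q ^ size j * (x r * q ^ j r) * q ^ size M) (p r) /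
        qRise q (a * q ^ size j * q * (x r * q ^ j r)) (p r)) := by
  have hX : ∀ r s, x r * q ^ j r / (x s * q ^ j s) = q ^ ((j r : ℤ) - j s) * (x r / x s) :=
    fun r s => by
      rw [zpow_sub₀ hq, zpow_natCast, zpow_natCast, mul_div_mul_comm, mul_comm]
  have hV : vandermonde q (fun r => x r * q ^ j r) p = ∏ r, ∏ s ∈ Finset.Ioi r,
      (1 - q ^ ((j r : ℤ) - (j s : ℤ) + (p r : ℤ) - (p s : ℤ)) * (x r / x s)) /
        (1 - q ^ ((j r : ℤ) - (j s : ℤ)) * (x r / x s)) := by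
    refine Finset.prod_congr rfl fun r _ => Finset.prod_congr rfl fun s _ => ?_
    rw [hX, ← mul_assoc, ← zpow_add₀ hq]
    ring_nf
  have hZ : ∏ r, ∏ s, qRise q (q ^ (-(M s : ℤ)) * (x r * q ^ j r / (x s * q ^ j s))) (p r) /
        qRise q (q * (x r * q ^ j r / (x s * q ^ j s))) (p r) =
      ∏ r, ∏ s, qRise q (q ^ ((j r : ℤ) - ((j + M) s : ℕ)) * (x r / x s)) (p r) /
          qRise q (q ^ (1 + (j r : ℤ) - (j s : ℤ)) * (x r / x s)) (p r) := by
    refine Finset.prod_congr rfl fun r _ => Finset.prod_congr rfl fun s _ => ?_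
    have e1 : (j r : ℤ) - ((j + M) s : ℕ) = -M s + (j r - j s) := by
      rw [Pi.add_apply]
      push_cast
      ring
    rw [hX, ← mul_assoc, ← mul_assoc, ← zpow_add₀ hq, ← zpow_one_add₀ hq, e1, add_sub_assoc]
  have hA : (∏ r, (qRise q (a * q * x r) (j r))⁻¹) *
      (∏ r, qRise q (a * q ^ size j * (x r * q ^ j r) * q ^ size M) (p r) /
        qRise q (a * q ^ size j * q * (x r * q ^ j r)) (p r)) =
      ∏ r, qRise q (a * x r * q ^ (j r + size (j + M))) (p r) *
          qRise q (a * x r * q ^ (1 + j r)) (p r) /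
          (qRise q (a * q * x r) (j r + p r) *
            qRise q (a * x r * q ^ (1 + j r + size j)) (p r)) := by
    rw [← Finset.prod_mul_distrib]
    refine Finset.prod_congr rfl fun r _ => ?_
    have e1 : a * q ^ size j * (x r * q ^ j r) * q ^ size M =
        a * x r * q ^ (j r + size (j + M)) := by rw [size_add]; ring
    have e2 : a * q ^ size j * q * (x r * q ^ j r) = a * x r * q ^ (1 + j r + size j) := by ring
    have e3 : qRise q (a * q * x r) (j r + p r) =
        qRise q (a * q * x r) (j r) * qRise q (a * x r * q ^ (1 + j r)) (p r) := by
      rw [qRise_add]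
      ring_nf
    have n1 : qRise q (a * x r * q ^ (1 + j r)) (p r) ≠ 0 := qRise_ne_zero fun i _ => by
      have := ha r (1 + j r + i)
      rwa [pow_add, ← mul_assoc] at this
    rw [e1, e2, e3]
    field_simp
  rw [innerWeight, hV, hZ, ← hA]
  ring

/-- The inverse kernel times the matrix of values of the basis functions is the identity. This is
the order of the factors in which the sum over `l` has a closed form. -/
theorem sum_invKernel_mul_lhsTerm {n : ℕ} {q a : ℂ} {x : Fin n → ℂ} (hq : q ≠ 0) (hq1 : ‖q‖ < 1)
    (hx0 : ∀ r, x r ≠ 0) (hx : ∀ r s, r ≠ s → ∀ i : ℤ, q ^ i * (x r / x s) ≠ 1)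
    (ha : ∀ r, ∀ i : ℕ, a * x r * q ^ i ≠ 1) (k j : Fin n → ℕ) :
    ∑ l ∈ Finset.Iic k, invKernel q a x k l * lhsTerm q a x (basisWeight q a x) (qPow q l) j =
      if k = j then 1 else 0 := by
  have hvan : ∀ l, ¬ j ≤ l →
      invKernel q a x k l * lhsTerm q a x (basisWeight q a x) (qPow q l) j = 0 := fun l hl => by
    rw [lhsTerm_qPow_eq_zero hx0 _ _ hl, mul_zero]
  split_ifs with hkj
  · subst hkj
    rw [Finset.sum_eq_single_of_mem k (Finset.mem_Iic.2 le_rfl) fun l hl hlk =>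
      hvan l fun h => hlk (le_antisymm (Finset.mem_Iic.1 hl) h)]
    exact invKernel_self_mul_lhsTerm hq hq1 hx0 hx ha k
  by_cases hjk : j ≤ k
  · obtain ⟨M, rfl⟩ := exists_add_of_le hjk
    have hM : M ≠ 0 := by
      rintro rfl
      exact hkj (add_zero j)
    rw [sum_Iic_eq_sum_add hjk hvan, add_tsub_cancel_left]
    simp_rw [invKernel_mul_lhsTerm hq hq1 hx0 hx ha, innerWeight_same hq ha]
    rw [← Finset.mul_sum, ← Finset.mul_sum, sum_vandermonde_mul_qRise_eq_zero hq hq1 _ _ _ hM,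
      mul_zero, mul_zero]
    · exact fun r => mul_ne_zero (hx0 r) (pow_ne_zero _ hq)
    · intro r s hrs i
      have := hx r s hrs (i + (j r - j s))
      rwa [zpow_add₀ hq, zpow_sub₀ hq, zpow_natCast, zpow_natCast, mul_assoc, mul_comm (_ / _),
        ← mul_div_mul_comm] at this
    · intro r i
      have := ha r (size j + 1 + j r + i)
      convert! this using 1
      ring
  · refine Finset.sum_eq_zero fun l hl => hvan l fun hjl => hjk (hjl.trans (Finset.mem_Iic.1 hl))

/-- The terminating expansion of an arbitrary function on the points `q^N`. It follows from
`sum_invKernel_mul_lhsTerm` because a one-sided inverse of a finite square matrix is two-sided. -/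
theorem expansion_qPow {n : ℕ} {q a : ℂ} {x : Fin n → ℂ} (hq : q ≠ 0) (hq1 : ‖q‖ < 1)
    (hx0 : ∀ r, x r ≠ 0) (hx : ∀ r s, r ≠ s → ∀ i : ℤ, q ^ i * (x r / x s) ≠ 1)
    (ha : ∀ r, ∀ i : ℕ, a * x r * q ^ i ≠ 1) (φ : (Fin n → ℕ) → ℂ) (N : Fin n → ℕ) :
    φ N = ∑ k ∈ Finset.Iic N, lhsTerm q a x (basisWeight q a x) (qPow q N) k *
      ∑ l ∈ Finset.Iic k, invKernel q a x k l * φ l := by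
  let G : Matrix (Finset.Iic N) (Finset.Iic N) ℂ := fun k l => invKernel q a x k l
  let F : Matrix (Finset.Iic N) (Finset.Iic N) ℂ := fun l k =>
    lhsTerm q a x (basisWeight q a x) (qPow q (l : Fin n → ℕ)) k
  have hext : ∀ k ≤ N, ∀ ψ : (Fin n → ℕ) → ℂ,
      ∑ l ∈ Finset.Iic k, invKernel q a x k l * ψ l =
        ∑ l : Finset.Iic N, invKernel q a x k l * ψ l := fun k hk ψ => by
    rw [Finset.sum_coe_sort (Finset.Iic N) fun l => invKernel q a x k l * ψ l]
    refine Finset.sum_subset (Finset.Iic_subset_Iic.2 hk) fun l _ hl => ?_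
    rw [invKernel_eq_zero hq hx0 a (fun h => hl (Finset.mem_Iic.2 h)), zero_mul]
  have hGF : G * F = 1 := by
    ext k j
    rw [Matrix.mul_apply, Matrix.one_apply]
    have h := sum_invKernel_mul_lhsTerm hq hq1 hx0 hx ha (k : Fin n → ℕ) j
    rw [hext _ (Finset.mem_Iic.1 k.2)] at h
    simpa only [Subtype.ext_iff] using h
  have hFG : F * G = 1 := mul_eq_one_comm.1 hGF
  let N' : Finset.Iic N := ⟨N, Finset.mem_Iic.2 le_rfl⟩
  have h := congrFun (congrArg (fun B => B.mulVec fun l : Finset.Iic N => φ l) hFG) N'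
  simp only [Matrix.one_mulVec, ← Matrix.mulVec_mulVec] at h
  rw [← Finset.sum_coe_sort (Finset.Iic N)]
  refine h.symm.trans (Finset.sum_congr rfl fun k _ => ?_)
  rw [hext _ (Finset.mem_Iic.1 k.2)]
  rfl

/-! ### The terminating identity -/

theorem tsum_lhsTerm_qPow {n : ℕ} {q : ℂ} {x : Fin n → ℂ} (hx0 : ∀ r, x r ≠ 0) (b : ℂ)
    (β : (Fin n → ℕ) → ℂ) {N k : Fin n → ℕ} (hNk : N ≤ k) :
    ∑' j, lhsTerm q b x β (qPow q N) j =
      ∑ j ∈ Finset.Iic k, lhsTerm q b x β (qPow q N) j :=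
  tsum_eq_sum fun _ hj => lhsTerm_qPow_eq_zero hx0 b β fun h =>
    hj (Finset.mem_Iic.2 (h.trans hNk))

/-- The middle sum is the expansion coefficient of the left-hand side. -/
theorem middleSum_eq_sum_invKernel {n : ℕ} {q a b : ℂ} {x : Fin n → ℂ} (hq : q ≠ 0)
    (hq1 : ‖q‖ < 1) (hx0 : ∀ r, x r ≠ 0)
    (hx : ∀ r s, r ≠ s → ∀ i : ℤ, q ^ i * (x r / x s) ≠ 1)
    (hb : ∀ r, ∀ i : ℕ, b * x r * q ^ i ≠ 1) (K : (Fin n → ℂ) → ℂ) (β : (Fin n → ℕ) → ℂ)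
    (k : Fin n → ℕ) :
    middleSum q a b x K β k =
      ∑ l ∈ Finset.Iic k, invKernel q a x k l * lhs q b x K β (qPow q l) := by
  have h : ∀ l ∈ Finset.Iic k, invKernel q a x k l * lhs q b x K β (qPow q l) =
      ∑ j ∈ Finset.Iic k, invKernel q a x k l * lhsTerm q b x β (qPow q l) j * K (qPow q l) :=
    fun l hl => by
      rw [lhs, tsum_lhsTerm_qPow hx0 b β (Finset.mem_Iic.1 hl), Finset.mul_sum, Finset.mul_sum]
      exact Finset.sum_congr rfl fun j _ => by ring
  rw [Finset.sum_congr rfl h, Finset.sum_comm, middleSum_eq]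
  refine Finset.sum_congr rfl fun j hj => ?_
  rw [sum_Iic_eq_sum_add (Finset.mem_Iic.1 hj) fun l hl => by
    rw [lhsTerm_qPow_eq_zero hx0 b β hl, mul_zero, zero_mul]]
  rw [innerSum_eq, Finset.mul_sum]
  refine Finset.sum_congr rfl fun m _ => ?_
  rw [invKernel_mul_lhsTerm hq hq1 hx0 hx hb]
  ring

theorem rhsTerm_qPow_eq_zero {n : ℕ} {q : ℂ} {x : Fin n → ℂ} (hx0 : ∀ r, x r ≠ 0) (a b : ℂ)
    (K : (Fin n → ℂ) → ℂ) (β : (Fin n → ℕ) → ℂ) {N k : Fin n → ℕ} (h : ¬ k ≤ N) :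
    rhsTerm q a b x K β (qPow q N) k = 0 := by
  rw [rhsTerm_eq, lhsTerm_qPow_eq_zero hx0 _ _ h, zero_mul]

theorem lhs_qPow_eq_rhs {n : ℕ} {q a b : ℂ} {x : Fin n → ℂ} (hq : q ≠ 0)
    (hq1 : ‖q‖ < 1) (hx0 : ∀ r, x r ≠ 0)
    (hx : ∀ r s, r ≠ s → ∀ i : ℤ, q ^ i * (x r / x s) ≠ 1)
    (ha : ∀ r, ∀ i : ℕ, a * x r * q ^ i ≠ 1)
    (hb : ∀ r, ∀ i : ℕ, b * x r * q ^ i ≠ 1) (K : (Fin n → ℂ) → ℂ) (β : (Fin n → ℕ) → ℂ)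
    (N : Fin n → ℕ) :
    lhs q b x K β (qPow q N) = rhs q a b x K β (qPow q N) := by
  rw [rhs, tsum_eq_sum (s := Finset.Iic N) fun k hk =>
    rhsTerm_qPow_eq_zero hx0 a b K β fun h => hk (Finset.mem_Iic.2 h)]
  simp_rw [rhsTerm_eq, middleSum_eq_sum_invKernel hq hq1 hx0 hx hb]
  exact expansion_qPow hq hq1 hx0 hx ha (fun l => lhs q b x K β (qPow q l)) N

/-! ### Analytic continuation from the points `q^N` -/

open Filter Topology in
/-- An analytic function on a polydisc is zero if it vanishes at all the points `q^N`:
the variables are freed one at a time by the identity theorem in one variable, since the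
powers of `q` accumulate at the centre of the disc. -/
theorem eq_zero_of_qPow_eq_zero {n : ℕ} {q : ℂ} (hq : q ≠ 0) (hq1 : ‖q‖ < 1) {ρ : Fin n → ℝ}
    (hρ : ∀ r, 0 < ρ r) {f : (Fin n → ℂ) → ℂ} (hf : AnalyticOnNhd ℂ f (polydisc ρ))
    (h : ∀ N : Fin n → ℕ, f (qPow q N) = 0) :
    ∀ y ∈ polydisc ρ, f y = 0 := by
  have main : ∀ S : Finset (Fin n), ∀ y ∈ polydisc ρ, (∀ r ∉ S, ∃ i : ℕ, y r = q ^ i) →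
      f y = 0 := by
    intro S
    induction S using Finset.induction_on with
    | empty =>
      intro y _ hyr
      choose N hN using fun r => hyr r (Finset.notMem_empty r)
      rw [show y = qPow q N from funext hN]
      exact h N
    | insert t S ht ih =>
      intro y hy hyr
      have hupd : ∀ z ∈ Metric.ball (0 : ℂ) (ρ t), Function.update y t z ∈ polydisc ρ := by
        intro z hz r
        by_cases hr : r = t
        · subst hr
          simpa using hz
        · simpa [hr] using hy r
      have hg : AnalyticOnNhd ℂ (fun z => f (Function.update y t z)) (Metric.ball 0 (ρ t)) := by
        refine hf.comp (fun z _ => ?_) hupd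
        refine analyticAt_pi_iff.2 fun r => ?_
        by_cases hr : r = t
        · subst hr
          simp only [Function.update_self]
          exact analyticAt_id
        · simpa [hr] using analyticAt_const
      have hlim : Tendsto (fun i : ℕ => q ^ i) atTop (𝓝[≠] 0) :=
        tendsto_nhdsWithin_iff.2 ⟨tendsto_pow_atTop_nhds_zero_of_norm_lt_one hq1,
          Eventually.of_forall fun i => pow_ne_zero i hq⟩
      have hball : ∀ᶠ i : ℕ in atTop, q ^ i ∈ Metric.ball (0 : ℂ) (ρ t) :=
        (tendsto_pow_atTop_nhds_zero_of_norm_lt_one hq1).eventually (Metric.ball_mem_nhds 0 (hρ t))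
      have hfreq : ∃ᶠ z in 𝓝[≠] (0 : ℂ), f (Function.update y t z) = 0 := by
        refine hlim.frequently (Eventually.frequently (hball.mono fun i hi => ?_))
        refine ih _ (hupd _ hi) fun r hr => ?_
        by_cases hrt : r = t
        · subst hrt
          exact ⟨i, by simp⟩
        · simpa [hrt] using hyr r (by simp [hrt, hr])
      have hz := hg.eqOn_zero_of_preconnected_of_frequently_eq_zero
        (convex_ball (0 : ℂ) (ρ t)).isPreconnected (Metric.mem_ball_self (hρ t)) hfreq
        (show y t ∈ Metric.ball (0 : ℂ) (ρ t) by simpa using hy t)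
      simpa using hz
  exact fun y hy => main Finset.univ y hy fun r hr => absurd (Finset.mem_univ r) hr

end AnSeries

theorem mainTheorem1 {n : ℕ} (q a b : ℂ) (x : Fin n → ℂ)
    (hq0 : q ≠ 0) (hq1 : ‖q‖ < 1)
    -- the denominators that do not involve `y` are never zero
    (hx0 : ∀ r, x r ≠ 0)
    (hx : ∀ r s, r ≠ s → ∀ i : ℤ, q ^ i * (x r / x s) ≠ 1)
    (ha : ∀ r, ∀ i : ℕ, a * x r * q ^ i ≠ 1)
    (hb : ∀ r, ∀ i : ℕ, b * x r * q ^ i ≠ 1)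
    (K : (Fin n → ℂ) → ℂ) (β : (Fin n → ℕ) → ℂ) :
    -- both sides are analytic and both series converge absolutely near the origin
    (∀ ρ : Fin n → ℝ, (∀ r, 0 < ρ r) →
      (∀ y ∈ AnSeries.polydisc ρ, ∀ r, ∀ i : ℕ,
        a * q * x r * y r * q ^ i ≠ 1 ∧ b * q * x r * y r * q ^ i ≠ 1) →
      (∀ y ∈ AnSeries.polydisc ρ, Summable fun j => ‖AnSeries.lhsTerm q b x β y j‖) →
      (∀ y ∈ AnSeries.polydisc ρ, Summable fun k => ‖AnSeries.rhsTerm q a b x K β y k‖) →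
      AnalyticOnNhd ℂ (AnSeries.lhs q b x K β) (AnSeries.polydisc ρ) →
      AnalyticOnNhd ℂ (AnSeries.rhs q a b x K β) (AnSeries.polydisc ρ) →
      ∀ y ∈ AnSeries.polydisc ρ, AnSeries.lhs q b x K β y = AnSeries.rhs q a b x K β y) ∧
    -- the terminating case `y = q^N`
    (∀ N : Fin n → ℕ,
      (∀ j, ¬ j ≤ N → AnSeries.lhsTerm q b x β (AnSeries.qPow q N) j = 0) ∧
      (∀ k, ¬ k ≤ N → AnSeries.rhsTerm q a b x K β (AnSeries.qPow q N) k = 0) ∧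
      AnSeries.lhs q b x K β (AnSeries.qPow q N) =
        AnSeries.rhs q a b x K β (AnSeries.qPow q N)) := by

  have hterm := AnSeries.lhs_qPow_eq_rhs hq0 hq1 hx0 hx ha hb K β
  refine ⟨fun ρ hρ _ _ _ hL hR y hy => ?_, fun N => ⟨fun j hj => ?_, fun k hk => ?_, hterm N⟩⟩
  · exact sub_eq_zero.1 (AnSeries.eq_zero_of_qPow_eq_zero hq0 hq1 hρ (hL.sub hR)
      (fun N => sub_eq_zero.2 (hterm N)) y hy)
  · exact AnSeries.lhsTerm_qPow_eq_zero hx0 b β hj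
  · exact AnSeries.rhsTerm_qPow_eq_zero hx0 a b K β hk
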